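/- Let $\alpha>1$. There is a constant $C$ depending only on $\alpha$ such that the following holds. Let $\mathcal X$ be a radial tree: a tree with origin $0$ and a function $\tilde q:\{0,1,2,\dots\}\to\{2,3,4,\dots\}$ such that every vertex $x$ has exactly $q(x)=\tilde q(|x|)$ children, where $|x|=d(x,0)$ (a child of $x$ is a neighbour of $x$ at distance $|x|+1$ from $0$). Let $\mu$ be the measure on $\mathcal X$ with $\mu(\{x\})=\prod_{\ell=0}^{|x|-1}\tilde q(\ell)^{-\alpha}$. Let $\mathcal A^2(\mathcal X)$ be the closed subspace of the real space $L^2(\mathcal X,\mu)$ that consists of the harmonic functions, that is, $f(x)=\frac1{\deg x}\sum_{y:\,d(x,y)=1}f(y)$ for every $x\in\mathcal X$. Let $\mathcal P$ be the orthogonal projection of $L^2(\mathcal X,\mu)$ onto $\mathcal A^2(\mathcal X)$, and $\mathcal K(x,y)$ its integral kernel (the reproducing kernel of $\mathcal A^2(\mathcal X)$). For $f\in L^1(\mathcal X,\mu)$ put $\mathcal Pf(x)=\sum_{y}\mathcal K(x,y)f(y)\mu(\{y\})$. For $x\in\mathcal X$ let $S_x$ be the sector of $x$, that is, the set of $x$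 and all its descendants, and let $\mathscr D$ be the collection of all singletons and all sectors (these are the sets in the partitions $\mathscr D_k=\{\{x\}:|x|<k\}\cup\{S_y:|y|=k\}$, $k\ge0$, of the filtration induced by the Gromov metric). A family $\mathcal S\subseteq\mathscr D$ is sparse if there are pairwise disjoint sets $E_Q\subseteq Q$, $Q\in\mathcal S$, with $\mu(E_Q)\ge\frac12\mu(Q)$. Write $\langle f\rangle_Q=\mu(Q)^{-1}\sum_{x\in Q}f(x)\mu(\{x\})$. For nonnegative functions $f_1,f_2$ on $\mathcal X$ put $$\mathcal A_{\mathcal S}f_1=\sum_{Q\in\mathcal S}\langle f_1\rangle_Q1_Q,\qquad \langle \mathcal A_{\mathcal S}f_1,f_2\rangle=\sum_{x}\mathcal A_{\mathcal S}f_1(x)f_2(x)\mu(\{x\}),$$ $$\mathcal E_{\mathcal S}(f_1,f_2)=\sum_{Q}\langle f_1\rangle_Q\Bigg(\frac1{q(x_Q^{(1)})}\sum_{R}\langle f_2\rangle_R\Bigg)\mu(Q).$$ In the last formula $Q$ runs over the sectors $Q\in\mathcal S$ with $Q\ne\mathcal X$, $x_Q^{(1)}$ is the parent of the vertex of $Q$,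 and $R$ runs over the sectors $R\in\mathcal S$ whose vertex is a child of $x_Q^{(1)}$ (including $R=Q$). These forms take values in $[0,\infty]$. Then for all real-valued $f_1,f_2\in L^1(\mathcal X,\mu)$ the series that defines $\mathcal Pf_1(x)$ converges absolutely for every $x$, and there is a sparse family $\mathcal S\subseteq\mathscr D$ with $$|\langle\mathcal Pf_1,f_2\rangle|\le C\,\big(\langle\mathcal A_{\mathcal S}|f_1|,|f_2|\rangle+\mathcal E_{\mathcal S}(|f_1|,|f_2|)\big),$$ where, whenever the right-hand side is finite, the series $\langle\mathcal Pf_1,f_2\rangle=\sum_x\mathcal Pf_1(x)f_2(x)\mu(\{x\})$ converges absolutely. If the right-hand side is infinite, nothing is claimed about the pairing. -/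

import Mathlib

open MeasureTheory Set
open scoped ENNReal NNReal

noncomputable section

/-- A radial tree: a tree with a distinguished vertex `root` and a function `branching`, with
values in `{2, 3, 4, …}`, such that each vertex `x` has exactly `branching |x|` children, where
`|x|` is the graph distance to `root`. The root has only its children as neighbours, any other
vertex has one more neighbour. -/
structure RadialTree (V : Type*) where
  graph : SimpleGraph V
  root : V
  branching : ℕ → ℕ
  isTree : graph.IsTree
  two_le_branching : ∀ n, 2 ≤ branching n
  encard_root : (graph.neighborSet root).encard = branching 0
  encard_of_ne_root : ∀ x, x ≠ root →
    (graph.neighborSet x).encard = branching (graph.dist root x) + 1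

namespace RadialTree

variable {V : Type*} (T : RadialTree V)

/-- The distance `|x|` of a vertex to the root. -/
def level (x : V) : ℕ := T.graph.dist T.root x

/-- The number `q(x)` of children of `x`. -/
def numChildren (x : V) : ℕ := T.branching (T.level x)

open Classical in
/-- The parent of a vertex `x ≠ root`: its neighbour which is closer to the root.
By convention the parent of the root is the root. -/
def parent (x : V) : V :=
  if h : ∃ y, T.graph.Adj x y ∧ T.level y + 1 = T.level x then h.choose else x

/-- The sector with vertex `x`: the vertex `x` and all its descendants. -/
def sector (x : V) : Set V := {y | ∃ k : ℕ, T.parent^[k] y = x}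

/-- The `k`-th partition: the singletons `{x}` with `|x| < k` and the sectors with vertex at
level `k`. -/
def partition (k : ℕ) : Set (Set V) :=
  {Q | ∃ x, T.level x < k ∧ Q = {x}} ∪ {Q | ∃ y, T.level y = k ∧ Q = T.sector y}

/-- The collection of all the sets in the partitions. -/
def dyadic : Set (Set V) := ⋃ k, T.partition k

/-- The combinatorial Laplacian. -/
def laplacian (f : V → ℝ) (x : V) : ℝ :=
  f x - ((T.graph.neighborSet x).ncard : ℝ)⁻¹ * ∑ᶠ y ∈ T.graph.neighborSet x, f y

/-- A function is harmonic if its Laplacian vanishes at all vertices. -/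
def IsHarmonic (f : V → ℝ) : Prop := ∀ x, T.laplacian f x = 0

lemma finite_neighborSet (x : V) : (T.graph.neighborSet x).Finite := by
  by_cases h : x = T.root
  · subst h
    exact Set.finite_of_encard_eq_coe T.encard_root
  · refine Set.finite_of_encard_eq_coe (k := T.branching (T.graph.dist T.root x) + 1) ?_
    rw [T.encard_of_ne_root x h]
    norm_cast

/-- The mass `∏_{ℓ < |x|} q̃(ℓ)^{-α}` of a vertex. -/
def weight (α : ℝ) (x : V) : ℝ :=
  ∏ l ∈ Finset.range (T.level x), 1 / (T.branching l : ℝ) ^ α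

lemma weight_pos (α : ℝ) (x : V) : 0 < T.weight α x := by
  refine Finset.prod_pos fun l _ => ?_
  have : (0 : ℝ) < T.branching l := by
    have := T.two_le_branching l
    exact_mod_cast (by omega : 0 < T.branching l)
  positivity

variable [MeasurableSpace V]

/-- The measure on the tree with `μ({x}) = weight x`. -/
def measure (α : ℝ) : Measure V :=
  Measure.sum fun x => ENNReal.ofReal (T.weight α x) • Measure.dirac x

variable [DiscreteMeasurableSpace V]

lemma measure_singleton (α : ℝ) (x : V) :
    T.measure α {x} = ENNReal.ofReal (T.weight α x) := by
  rw [measure, Measure.sum_apply _ (MeasurableSet.of_discrete), tsum_eq_single x]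
  · simp
  · intro y hy
    simp [hy]

lemma measure_singleton_ne_top (α : ℝ) (x : V) : T.measure α {x} ≠ ∞ := by
  simp [measure_singleton]

lemma real_singleton (α : ℝ) (x : V) : (T.measure α).real {x} = T.weight α x := by
  rw [measureReal_def, measure_singleton, ENNReal.toReal_ofReal (T.weight_pos α x).le]

lemma eq_of_ae_eq {α : ℝ} {f g : V → ℝ} (h : f =ᵐ[T.measure α] g) : f = g := by
  funext x
  by_contra hx
  have h0 : T.measure α {x} = 0 := by
    refine measure_mono_null ?_ (ae_iff.1 h)
    rintro y rfl
    exact hx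
  rw [measure_singleton, ENNReal.ofReal_eq_zero] at h0
  exact absurd h0 (not_le.2 (T.weight_pos α x))

/-- The function `μ({x})⁻¹ 1_{x}` in `L²`, which represents the evaluation at `x`. -/
def evalVec (α : ℝ) (x : V) : Lp ℝ 2 (T.measure α) :=
  (T.weight α x)⁻¹ • indicatorConstLp 2 (MeasurableSet.of_discrete (s := {x}))
    (T.measure_singleton_ne_top α x) (1 : ℝ)

lemma inner_evalVec (α : ℝ) (x : V) (f : Lp ℝ 2 (T.measure α)) :
    inner ℝ (T.evalVec α x) f = f x := by
  rw [evalVec, real_inner_smul_left, L2.inner_indicatorConstLp_one, integral_singleton,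
    real_singleton, smul_eq_mul, inv_mul_cancel_left₀ (T.weight_pos α x).ne']

/-- The Bergman space: the harmonic functions in `L²`. All points have positive measure, so an
element of `L²` is the same as a function. -/
def bergmanSpace (α : ℝ) : Submodule ℝ (Lp ℝ 2 (T.measure α)) where
  carrier := {f | T.IsHarmonic f}
  zero_mem' := by
    intro x
    rw [T.eq_of_ae_eq (Lp.coeFn_zero ℝ 2 (T.measure α))]
    simp [laplacian]
  add_mem' := by
    intro f g hf hg x
    have h1 := hf x
    have h2 := hg x
    rw [T.eq_of_ae_eq (Lp.coeFn_add f g)]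
    simp only [laplacian, Pi.add_apply] at h1 h2 ⊢
    rw [finsum_mem_add_distrib (T.finite_neighborSet x)]
    linear_combination h1 + h2
  smul_mem' := by
    intro c f hf x
    have h1 := hf x
    rw [T.eq_of_ae_eq (Lp.coeFn_smul c f)]
    simp only [laplacian, Pi.smul_apply, smul_eq_mul,
      finsum_mem_eq_finite_toFinset_sum _ (T.finite_neighborSet x), ← Finset.mul_sum] at h1 ⊢
    linear_combination c * h1

lemma isClosed_bergmanSpace (α : ℝ) :
    IsClosed (T.bergmanSpace α : Set (Lp ℝ 2 (T.measure α))) := by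
  have hc : ∀ x, Continuous fun f : Lp ℝ 2 (T.measure α) => f x := by
    intro x
    simp_rw [← T.inner_evalVec α x]
    fun_prop
  have : (T.bergmanSpace α : Set (Lp ℝ 2 (T.measure α))) =
      ⋂ x, {f : Lp ℝ 2 (T.measure α) | T.laplacian f x = 0} := by
    ext f
    simp [bergmanSpace, IsHarmonic]
  rw [this]
  refine isClosed_iInter fun x => isClosed_eq ?_ continuous_const
  simp only [laplacian, finsum_mem_eq_finite_toFinset_sum _ (T.finite_neighborSet x)]
  exact (hc x).sub (continuous_const.mul (continuous_finsetSum _ fun y _ => hc y))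

instance (α : ℝ) : CompleteSpace (T.bergmanSpace α) :=
  (T.isClosed_bergmanSpace α).completeSpace_coe

/-- The Bergman projector on `L²`: the orthogonal projection onto the Bergman space. -/
def bergmanProjL2 (α : ℝ) : Lp ℝ 2 (T.measure α) →L[ℝ] Lp ℝ 2 (T.measure α) :=
  (T.bergmanSpace α).starProjection

/-- The integral kernel of the Bergman projector (the reproducing kernel of the Bergman space). -/
def bergmanKernel (α : ℝ) (x y : V) : ℝ := T.bergmanProjL2 α (T.evalVec α x) y

/-- The Bergman projector as an integral operator, as it acts on `L¹`. -/
def bergmanProj (α : ℝ) (f : V → ℝ) (x : V) : ℝ :=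
  ∫ y, T.bergmanKernel α x y * f y ∂(T.measure α)

/-- On `L²` the integral operator is the orthogonal projection. -/
lemma bergmanProj_eq_bergmanProjL2 (α : ℝ) (f : Lp ℝ 2 (T.measure α)) :
    T.bergmanProj α f = T.bergmanProjL2 α f := by
  funext x
  rw [← T.inner_evalVec α x, bergmanProjL2, ← Submodule.inner_starProjection_left_eq_right,
    L2.inner_def, bergmanProj]
  refine integral_congr_ae (ae_of_all _ fun y => ?_)
  simp [bergmanKernel, bergmanProjL2, mul_comm]

/-- A sparse family of sets of the filtration: each `Q` in the family has a subset `E Q` with at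
least half of its measure, and the sets `E Q` are pairwise disjoint. -/
def IsSparse (α : ℝ) (S : Set (Set V)) : Prop :=
  S ⊆ T.dyadic ∧ ∃ E : Set V → Set V,
    (∀ Q ∈ S, E Q ⊆ Q ∧ T.measure α Q / 2 ≤ T.measure α (E Q)) ∧ S.PairwiseDisjoint E

/-- The average of `|f|` over `Q`. -/
def avg (α : ℝ) (f : V → ℝ) (Q : Set V) : ℝ≥0∞ := ⨍⁻ x in Q, ‖f x‖ₑ ∂(T.measure α)

/-- The sparse operator `∑_{Q ∈ S} ⟨|f|⟩_Q 1_Q(x)` applied to `|f|`. -/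
def sparseOp (α : ℝ) (S : Set (Set V)) (f : V → ℝ) (x : V) : ℝ≥0∞ :=
  ∑' Q : S, (Q : Set V).indicator (fun _ => T.avg α f Q) x

/-- The sparse form, the pairing of the sparse operator applied to `|f₁|` with `|f₂|`. -/
def sparseForm (α : ℝ) (S : Set (Set V)) (f₁ f₂ : V → ℝ) : ℝ≥0∞ :=
  ∫⁻ x, T.sparseOp α S f₁ x * ‖f₂ x‖ₑ ∂(T.measure α)

/-- The off-diagonal form. The outer sum is over the sectors `Q = sector y` in `S` other than the
whole tree, and the inner sum is over the sectors `R = sector z` in `S` with the same parent as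
`Q`, the sector `Q` included. Different vertices have different sectors. -/
def extraForm (α : ℝ) (S : Set (Set V)) (f₁ f₂ : V → ℝ) : ℝ≥0∞ :=
  ∑' y : {y : V // y ≠ T.root ∧ T.sector y ∈ S},
    T.avg α f₁ (T.sector y) *
      ((T.numChildren (T.parent y) : ℝ≥0∞)⁻¹ *
        ∑' z : {z : V // z ≠ T.root ∧ T.sector z ∈ S ∧ T.parent z = T.parent y},
          T.avg α f₂ (T.sector z)) *
      T.measure α (T.sector y)

end RadialTree

end

/-!
The Bergman space of a radial tree has an explicit reproducing kernel. For a vertex `u ≠ root` let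
`h_u` be the function which vanishes off the sector of `u` and is radial on it, equal to `1` at `u`
and harmonic there, with the value `0` at the parent of `u`; on the sector its values lie in
`[1, 2]` (`one_le_profile`, `profile_le_two`). The only vertex at which `h_u` is not harmonic is the parent
of `u` (`flux_sectorProfile`), and the defect does not depend on which child of that parent `u` is.
So the difference of `h_u` and the mean of `h_v` over `u` and its siblings `v` is harmonic
(`flux_siblingDifference`).

Conversely a harmonic function `f` has constant flux through the generations of a sector, hence
its sums over the generations of the sector of `u` are those of
`f (parent u) + (f u - f (parent u)) h_u` (`sum_generation_harmonic`). The weight is radial, so the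
pairing of `f` with a sibling difference is `‖h_u‖²` times the deviation of `f u` from the mean of
`f` over the siblings (`integral_siblingDifference_mul`). Summation by parts along the geodesic from
the root to `x` recovers `f x` from these deviations and `f root`. This shows that
`explicitKernel` reproduces harmonic functions, so it is the Bergman kernel (`bergmanKernel_eq`).

Up to a factor `4`, the formula bounds `|K(x, y)|` by the sum of `1 / μ(S_u)` over the sectors
`S_u` containing both points, plus the sum of `1 / (q(parent v) μ(S_v))` over the pairs of siblings
`v`, `z` with `y ∈ S_v`, `x ∈ S_z` (`enorm_bergmanKernel_le`). Integrating this against `|f₁|` and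
`|f₂|` gives the diagonal and the off-diagonal form over the family of all sectors
(`lintegral_enorm_bergmanProj_mul_le`).

The family of all sectors need not be sparse if `α` is close to `1`, but the mass of a generation decays
at least like `2 ^ ((1 - α) k)`, so for a suitable `m` which depends only on `α` the first `m`
generations of a sector carry half of its mass. The sectors with level in a fixed residue class
modulo `m` are then sparse (`isSparse_residueSectors`). Both forms couple only sectors of the same
level, so the forms over all sectors are the sums of those over the `m` residue classes. The class
with the largest form is the sparse family sought, with the constant `4 * m`
(`exists_residue_lintegral_le`).
-/

open MeasureTheory Set
open scoped ENNReal NNReal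

noncomputable section

namespace RadialTree

variable {V : Type*} (T : RadialTree V)

/-! ### Parents and children -/

lemma level_root : T.level T.root = 0 := by simp [level]

lemma level_eq_zero {x : V} : T.level x = 0 ↔ x = T.root := by
  rw [level, T.isTree.connected.dist_eq_zero_iff, eq_comm]

lemma level_pos {x : V} (hx : x ≠ T.root) : 0 < T.level x :=
  Nat.pos_of_ne_zero fun h => hx (T.level_eq_zero.1 h)

lemma level_of_adj {x y : V} (h : T.graph.Adj x y) :
    T.level y = T.level x + 1 ∨ T.level x = T.level y + 1 :=
  (T.isTree.dist_eq_dist_add_one_of_adj T.root h).symm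

lemma exists_adj_level {x : V} (hx : x ≠ T.root) :
    ∃ y, T.graph.Adj x y ∧ T.level y + 1 = T.level x := by
  obtain ⟨p, hp⟩ := T.isTree.connected.exists_walk_length_eq_dist x T.root
  cases p with
  | nil => exact absurd rfl hx
  | cons h q =>
    refine ⟨_, h, ?_⟩
    have h1 := SimpleGraph.dist_le q
    rw [SimpleGraph.Walk.length_cons, SimpleGraph.dist_comm] at hp
    rw [SimpleGraph.dist_comm] at h1
    have h2 := T.level_of_adj h
    unfold level at *
    omega

lemma eq_of_adj_level {x y z : V} (hy : T.graph.Adj x y) (hyl : T.level y + 1 = T.level x)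
    (hz : T.graph.Adj x z) (hzl : T.level z + 1 = T.level x) : y = z := by
  -- Geodesics from the root through `y` and through `z` are two paths to `x`.
  have key : ∀ w, T.graph.Adj x w → T.level w + 1 = T.level x →
      ∃ p : T.graph.Walk T.root x, p.IsPath ∧ p.penultimate = w := by
    intro w hw hwl
    obtain ⟨p, hp⟩ := T.isTree.connected.exists_walk_length_eq_dist T.root w
    refine ⟨p.concat hw.symm, SimpleGraph.Walk.isPath_of_length_eq_dist _ ?_, ?_⟩
    · rw [SimpleGraph.Walk.length_concat, hp]
      exact hwl
    · simp
  obtain ⟨p, hp, rfl⟩ := key y hy hyl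
  obtain ⟨p', hp', rfl⟩ := key z hz hzl
  rw [(T.isTree.existsUnique_path T.root x).unique hp hp']

lemma parent_spec {x : V} (hx : x ≠ T.root) :
    T.graph.Adj x (T.parent x) ∧ T.level (T.parent x) + 1 = T.level x := by
  have h := T.exists_adj_level hx
  rw [parent, dif_pos h]
  exact h.choose_spec

lemma parent_root : T.parent T.root = T.root := by
  rw [parent, dif_neg]
  rintro ⟨y, -, hy⟩
  rw [level_root] at hy
  omega

lemma parent_eq {x y : V} (h : T.graph.Adj x y) (hl : T.level y + 1 = T.level x) :
    T.parent x = y := by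
  have hx : x ≠ T.root := by
    rintro rfl
    rw [level_root] at hl
    omega
  exact T.eq_of_adj_level (T.parent_spec hx).1 (T.parent_spec hx).2 h hl

lemma level_parent (x : V) : T.level (T.parent x) = T.level x - 1 := by
  by_cases hx : x = T.root
  · rw [hx, parent_root, level_root]
  · have := (T.parent_spec hx).2
    omega

lemma level_iterate_parent (k : ℕ) (x : V) : T.level (T.parent^[k] x) = T.level x - k := by
  induction k with
  | zero => rfl
  | succ k ih =>
    rw [Function.iterate_succ_apply', level_parent, ih]
    omega

lemma iterate_parent_eq_root {k : ℕ} {x : V} (h : T.level x ≤ k) : T.parent^[k] x = T.root := by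
  rw [← T.level_eq_zero, level_iterate_parent]
  omega

lemma finite_children (x : V) : {y | y ≠ T.root ∧ T.parent y = x}.Finite := by
  refine (T.finite_neighborSet x).subset ?_
  rintro y ⟨hy, rfl⟩
  exact (T.parent_spec hy).1.symm

/-- The children of a vertex. -/
def children (x : V) : Finset V := (T.finite_children x).toFinset

@[simp]
lemma mem_children {x y : V} : y ∈ T.children x ↔ y ≠ T.root ∧ T.parent y = x := by
  simp [children]

lemma level_of_mem_children {x y : V} (h : y ∈ T.children x) : T.level y = T.level x + 1 := by
  rw [mem_children] at h
  rw [← h.2, (T.parent_spec h.1).2]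

lemma mem_children_iff_adj {x y : V} :
    y ∈ T.children x ↔ T.graph.Adj x y ∧ T.level y = T.level x + 1 := by
  refine ⟨fun h => ⟨?_, T.level_of_mem_children h⟩, fun ⟨h, hl⟩ => ?_⟩
  · rw [mem_children] at h
    rw [← h.2]
    exact (T.parent_spec h.1).1.symm
  · rw [mem_children]
    refine ⟨?_, T.parent_eq h.symm hl.symm⟩
    rintro rfl
    rw [level_root] at hl
    omega

lemma neighborSet_root : T.graph.neighborSet T.root = T.children T.root := by
  ext y
  rw [SimpleGraph.mem_neighborSet, Finset.mem_coe, mem_children_iff_adj]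
  refine ⟨fun h => ⟨h, ?_⟩, fun h => h.1⟩
  have h1 := T.level_of_adj h
  rw [level_root] at h1 ⊢
  omega

lemma parent_notMem_children {x : V} (hx : x ≠ T.root) : T.parent x ∉ T.children x := by
  intro h
  have h1 := T.level_of_mem_children h
  have h2 := (T.parent_spec hx).2
  omega

lemma neighborSet_of_ne_root {x : V} (hx : x ≠ T.root) :
    T.graph.neighborSet x =
      (Finset.cons (T.parent x) (T.children x) (T.parent_notMem_children hx) : Finset V) := by
  ext y
  rw [SimpleGraph.mem_neighborSet, Finset.mem_coe, Finset.mem_cons, mem_children_iff_adj]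
  constructor
  · intro h
    rcases T.level_of_adj h with h1 | h1
    · exact Or.inr ⟨h, h1⟩
    · exact Or.inl (T.parent_eq h h1.symm).symm
  · rintro (rfl | h)
    · exact (T.parent_spec hx).1
    · exact h.1

lemma card_children (x : V) : (T.children x).card = T.branching (T.level x) := by
  by_cases hx : x = T.root
  · have h := T.encard_root
    rw [neighborSet_root, Set.encard_coe_eq_coe_finsetCard] at h
    rw [hx, level_root]
    exact_mod_cast h
  · have h := T.encard_of_ne_root x hx
    rw [neighborSet_of_ne_root T hx, Set.encard_coe_eq_coe_finsetCard, Finset.card_cons] at h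
    have h' : (T.children x).card + 1 = T.branching (T.graph.dist T.root x) + 1 := by
      exact_mod_cast h
    exact Nat.succ_injective h'

lemma branching_pos (n : ℕ) : (0 : ℝ) < T.branching n := by
  have := T.two_le_branching n
  exact_mod_cast (by omega : 0 < T.branching n)

lemma two_le_branching_real (n : ℕ) : (2 : ℝ) ≤ T.branching n := by
  exact_mod_cast T.two_le_branching n

/-- The flux form of harmonicity: what flows into a vertex from its parent flows out to its
children. At the root, which is its own parent, the inflow is `0`. -/
lemma isHarmonic_iff {f : V → ℝ} :
    T.IsHarmonic f ↔ ∀ x, ∑ z ∈ T.children x, (f z - f x) = f x - f (T.parent x) := by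
  refine forall_congr' fun x => ?_
  have hq := T.branching_pos (T.level x)
  by_cases hx : x = T.root
  · subst hx
    rw [laplacian, neighborSet_root, finsum_mem_coe_finset, Set.ncard_coe_finset,
      Finset.sum_sub_distrib, Finset.sum_const, nsmul_eq_mul, card_children, parent_root, sub_self,
      sub_eq_zero, sub_eq_zero, eq_inv_mul_iff_mul_eq₀ hq.ne', eq_comm]
  · rw [laplacian, neighborSet_of_ne_root T hx, finsum_mem_coe_finset, Set.ncard_coe_finset,
      Finset.sum_sub_distrib, Finset.sum_const, nsmul_eq_mul, Finset.card_cons, Finset.sum_cons,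
      card_children, sub_eq_zero, eq_inv_mul_iff_mul_eq₀ (by positivity)]
    push_cast
    constructor <;> intro h <;> linarith

/-! ### Sectors and generations -/

lemma mem_sector_iff {x y : V} :
    y ∈ T.sector x ↔ T.level x ≤ T.level y ∧ T.parent^[T.level y - T.level x] y = x := by
  constructor
  · rintro ⟨k, rfl⟩
    rw [level_iterate_parent]
    refine ⟨by omega, ?_⟩
    by_cases hk : k ≤ T.level y
    · rw [Nat.sub_sub_self hk]
    · rw [T.iterate_parent_eq_root (by omega), T.iterate_parent_eq_root (by omega)]
  · exact fun h => ⟨_, h.2⟩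

lemma self_mem_sector (x : V) : x ∈ T.sector x := ⟨0, rfl⟩

lemma level_le_of_mem_sector {x y : V} (h : y ∈ T.sector x) : T.level x ≤ T.level y :=
  (T.mem_sector_iff.1 h).1

lemma sector_root : T.sector T.root = univ :=
  eq_univ_of_forall fun _ => ⟨_, T.iterate_parent_eq_root le_rfl⟩

lemma eq_of_mem_sector {x x' y : V} (h : y ∈ T.sector x) (h' : y ∈ T.sector x')
    (hl : T.level x = T.level x') : x = x' := by
  rw [← (T.mem_sector_iff.1 h).2, ← (T.mem_sector_iff.1 h').2, hl]

lemma sector_injective : Function.Injective T.sector := by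
  intro x x' h
  have h1 : x ∈ T.sector x' := h ▸ T.self_mem_sector x
  have h2 : x' ∈ T.sector x := h ▸ T.self_mem_sector x'
  exact T.eq_of_mem_sector (T.self_mem_sector x) h1
    (le_antisymm (T.level_le_of_mem_sector h2) (T.level_le_of_mem_sector h1))

lemma mem_sector_of_parent_mem {x y : V} (h : T.parent y ∈ T.sector x) : y ∈ T.sector x := by
  obtain ⟨k, hk⟩ := h
  exact ⟨k + 1, hk⟩

lemma parent_mem_sector {x y : V} (h : y ∈ T.sector x) (hne : y ≠ x) :
    T.parent y ∈ T.sector x := by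
  obtain ⟨k, hk⟩ := h
  cases k with
  | zero => exact absurd hk hne
  | succ k => exact ⟨k, hk⟩

open Classical in
/-- The descendants of a vertex which are `k` levels below it. -/
def generation (x : V) : ℕ → Finset V
  | 0 => {x}
  | k + 1 => (generation x k).biUnion T.children

lemma level_of_mem_generation {x y : V} {k : ℕ} (h : y ∈ T.generation x k) :
    T.level y = T.level x + k := by
  induction k generalizing y with
  | zero =>
    simp only [generation, Finset.mem_singleton] at h
    rw [h, add_zero]
  | succ k ih =>
    simp only [generation, Finset.mem_biUnion] at h
    obtain ⟨z, hz, hy⟩ := h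
    rw [T.level_of_mem_children hy, ih hz, add_assoc]

open Classical in
lemma mem_generation {x y : V} {k : ℕ} :
    y ∈ T.generation x k ↔ y ∈ T.sector x ∧ T.level y = T.level x + k := by
  refine ⟨fun h => ⟨?_, T.level_of_mem_generation h⟩, ?_⟩
  · induction k generalizing y with
    | zero =>
      simp only [generation, Finset.mem_singleton] at h
      exact h ▸ T.self_mem_sector x
    | succ k ih =>
      simp only [generation, Finset.mem_biUnion] at h
      obtain ⟨z, hz, hy⟩ := h
      rw [mem_children] at hy
      exact T.mem_sector_of_parent_mem (hy.2 ▸ ih hz)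
  · induction k generalizing y with
    | zero =>
      rintro ⟨h, hl⟩
      rw [generation, Finset.mem_singleton]
      exact T.eq_of_mem_sector (T.self_mem_sector y) h hl
    | succ k ih =>
      rintro ⟨h, hl⟩
      rw [generation, Finset.mem_biUnion]
      have hy : y ≠ T.root := by
        rw [ne_eq, ← T.level_eq_zero]
        omega
      refine ⟨T.parent y, ih ⟨T.parent_mem_sector h ?_, ?_⟩, T.mem_children.2 ⟨hy, rfl⟩⟩
      · rintro rfl
        omega
      · rw [level_parent]
        omega

open Classical in
lemma sum_generation_succ (x : V) (k : ℕ) (f : V → ℝ) :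
    ∑ y ∈ T.generation x (k + 1), f y =
      ∑ y ∈ T.generation x k, ∑ z ∈ T.children y, f z := by
  rw [generation, Finset.sum_biUnion]
  intro y _ y' _ hne
  rw [Function.onFun, Finset.disjoint_left]
  intro z hz hz'
  rw [mem_children] at hz hz'
  exact hne (hz.2.symm.trans hz'.2)

lemma card_generation (x : V) (k : ℕ) :
    ((T.generation x k).card : ℝ) = ∏ i ∈ Finset.range k, (T.branching (T.level x + i) : ℝ) := by
  induction k with
  | zero => simp [generation]
  | succ k ih =>
    have h := T.sum_generation_succ x k fun _ => 1
    simp only [Finset.sum_const, nsmul_eq_mul, mul_one] at h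
    rw [h, Finset.sum_congr rfl (g := fun _ => (T.branching (T.level x + k) : ℝ)),
      Finset.sum_const, nsmul_eq_mul, ih, Finset.prod_range_succ]
    intro y hy
    rw [card_children, T.level_of_mem_generation hy]

lemma iUnion_generation (x : V) : ⋃ k, (T.generation x k : Set V) = T.sector x := by
  ext y
  simp only [mem_iUnion, Finset.mem_coe, mem_generation]
  refine ⟨fun ⟨_, h⟩ => h.1, fun h => ⟨T.level y - T.level x, h, ?_⟩⟩
  have := T.level_le_of_mem_sector h
  omega

lemma pairwise_disjoint_generation (x : V) :
    Pairwise (Function.onFun Disjoint fun k => (T.generation x k : Set V)) := by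
  intro k l hkl
  rw [Function.onFun, Set.disjoint_left]
  intro y hk hl
  have h1 := T.level_of_mem_generation hk
  have h2 := T.level_of_mem_generation hl
  omega

lemma countable_vertices (T : RadialTree V) : Countable V := by
  rw [← Set.countable_univ_iff, ← T.sector_root, ← T.iUnion_generation]
  exact Set.countable_iUnion fun k => (T.generation T.root k).countable_toSet

/-- The ancestor of a vertex at a given level (the vertex itself if the level is too large). -/
def ancestor (x : V) (n : ℕ) : V := T.parent^[T.level x - n] x

lemma level_ancestor {x : V} {n : ℕ} (h : n ≤ T.level x) : T.level (T.ancestor x n) = n := by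
  rw [ancestor, level_iterate_parent]
  omega

lemma mem_sector_ancestor (x : V) (n : ℕ) : x ∈ T.sector (T.ancestor x n) := ⟨_, rfl⟩

lemma ancestor_level (x : V) : T.ancestor x (T.level x) = x := by simp [ancestor]

lemma ancestor_zero (x : V) : T.ancestor x 0 = T.root := T.iterate_parent_eq_root le_rfl

lemma parent_ancestor_succ {x : V} {n : ℕ} (h : n < T.level x) :
    T.parent (T.ancestor x (n + 1)) = T.ancestor x n := by
  rw [ancestor, ancestor, ← Function.iterate_succ_apply' (f := T.parent)]
  congr 2
  omega

lemma ancestor_succ_mem_children {x : V} {n : ℕ} (h : n < T.level x) :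
    T.ancestor x (n + 1) ∈ T.children (T.ancestor x n) := by
  rw [mem_children]
  refine ⟨fun h0 => ?_, T.parent_ancestor_succ h⟩
  rw [← T.level_eq_zero, T.level_ancestor (by omega)] at h0
  omega

lemma ancestor_succ_ne_root {x : V} {j : ℕ} (h : j < T.level x) :
    T.ancestor x (j + 1) ≠ T.root :=
  (T.mem_children.1 (T.ancestor_succ_mem_children h)).1

lemma level_of_mem_siblings {u v : V} (hu : u ≠ T.root) (hv : v ∈ T.children (T.parent u)) :
    T.level v = T.level u := by
  rw [T.level_of_mem_children hv, (T.parent_spec hu).2]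

/-! ### Sums over ancestors and their siblings -/

lemma injOn_ancestor (x : V) : InjOn (T.ancestor x) (Finset.range (T.level x + 1)) := by
  intro i hi j hj h
  rw [Finset.mem_coe, Finset.mem_range] at hi hj
  rw [← T.level_ancestor (x := x) (n := i) (by omega), h, T.level_ancestor (by omega)]

lemma sum_ancestor_le_tsum (x : V) (g : V → ℝ≥0∞) :
    ∑ j ∈ Finset.range (T.level x + 1), g (T.ancestor x j) ≤
      ∑' u, (T.sector u).indicator (fun _ => 1) x * g u := by
  classical
  refine le_trans (le_of_eq ?_)
    (ENNReal.sum_le_tsum ((Finset.range (T.level x + 1)).image (T.ancestor x)))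
  rw [Finset.sum_image (T.injOn_ancestor x)]
  refine Finset.sum_congr rfl fun j _ => ?_
  rw [indicator_of_mem (T.mem_sector_ancestor x j), one_mul]

/-- The children of the proper ancestors of `x` are vertices one of whose siblings, the vertex
itself included, has `x` in its sector. -/
lemma sum_siblings_le_tsum (x : V) (g : V → ℝ≥0∞) :
    ∑ j ∈ Finset.range (T.level x), ∑ v ∈ T.children (T.ancestor x j), g v ≤
      ∑' v : {v // v ≠ T.root}, (∑' z : {z : V // z ≠ T.root ∧ T.parent z = T.parent v},
        (T.sector z).indicator (fun _ => 1) x) * g v := by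
  classical
  have hdisj : ((Finset.range (T.level x) : Finset ℕ) : Set ℕ).PairwiseDisjoint
      fun j => T.children (T.ancestor x j) := by
    intro i hi j hj hne
    rw [Finset.mem_coe, Finset.mem_range] at hi hj
    rw [Function.onFun, Finset.disjoint_left]
    intro v hv hv'
    have h1 := T.level_of_mem_children hv
    have h2 := T.level_of_mem_children hv'
    rw [T.level_ancestor hi.le] at h1
    rw [T.level_ancestor hj.le] at h2
    omega
  rw [← Finset.sum_biUnion hdisj]
  set s := (Finset.range (T.level x)).biUnion fun j => T.children (T.ancestor x j)
  have hs : ∀ v ∈ s, v ≠ T.root ∧ ∃ z : {z : V // z ≠ T.root ∧ T.parent z = T.parent v},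
      x ∈ T.sector z := by
    intro v hv
    obtain ⟨j, hj, hvj⟩ := Finset.mem_biUnion.1 hv
    rw [Finset.mem_range] at hj
    rw [mem_children] at hvj
    refine ⟨hvj.1, ⟨T.ancestor x (j + 1), T.ancestor_succ_ne_root hj, ?_⟩,
      T.mem_sector_ancestor x _⟩
    rw [T.parent_ancestor_succ hj, hvj.2]
  rw [← Finset.sum_attach]
  refine le_trans (Finset.sum_le_sum fun v _ => ?_) ((ENNReal.sum_le_tsum s.attach).trans
    (ENNReal.tsum_comp_le_tsum_of_injective (f := fun v : {v // v ∈ s} =>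
      (⟨v, (hs v v.2).1⟩ : {v // v ≠ T.root})) ?_ _))
  · obtain ⟨z, hz⟩ := (hs v v.2).2
    refine le_mul_of_one_le_left zero_le (le_trans (le_of_eq ?_) (ENNReal.le_tsum z))
    rw [indicator_of_mem hz]
  · intro v w h
    exact Subtype.ext (Subtype.mk.inj h)

/-! ### Residue classes of levels -/

/-- The sectors whose vertices have a level in a given residue class modulo `m`. -/
def residueSectors (m k : ℕ) : Set (Set V) := T.sector '' {u | T.level u % m = k}

lemma sector_mem_residueSectors {m k : ℕ} {u : V} :
    T.sector u ∈ T.residueSectors m k ↔ T.level u % m = k :=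
  T.sector_injective.mem_set_image

lemma tsum_eq_sum_residues {ι : Type*} (c : ι → ℕ) {m : ℕ} (hm : 0 < m) (g : ι → ℝ≥0∞) :
    ∑' i, g i = ∑ k ∈ Finset.range m, ∑' i : {i | c i % m = k}, g i := by
  simp_rw [tsum_subtype {i | c i % m = _} g]
  rw [← Summable.tsum_finsetSum fun _ _ => ENNReal.summable]
  refine tsum_congr fun i => ?_
  rw [Finset.sum_eq_single_of_mem (c i % m) (Finset.mem_range.2 (Nat.mod_lt _ hm)),
    indicator_of_mem (show i ∈ {i' | c i' % m = c i % m} from rfl)]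
  intro k _ hk
  rw [indicator_of_notMem]
  exact fun h => hk (Eq.symm h)

/-! ### The radial profile of the harmonic functions carried by a sector -/

/-- The value at level `m` of the function on the sector of a vertex `u` at level `n` which is
radial, equal to `1` at `u`, and harmonic on the sector if it is extended by `0` to the parent of
`u`. For `m < n` the sum is empty and the value is `0`. -/
def profile (n m : ℕ) : ℝ :=
  ∑ i ∈ Finset.range (m + 1 - n), ∏ l ∈ Finset.range i, (T.branching (n + l) : ℝ)⁻¹

lemma profile_of_lt {n m : ℕ} (h : m < n) : T.profile n m = 0 := by
  rw [profile, Nat.sub_eq_zero_of_le (by omega), Finset.sum_range_zero]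

lemma profile_self (n : ℕ) : T.profile n n = 1 := by
  rw [profile, Nat.add_sub_cancel_left, Finset.sum_range_one, Finset.prod_range_zero]

lemma profile_add_succ (n k : ℕ) :
    T.profile n (n + k + 1) =
      T.profile n (n + k) + ∏ l ∈ Finset.range (k + 1), (T.branching (n + l) : ℝ)⁻¹ := by
  rw [profile, profile, show n + k + 1 + 1 - n = k + 1 + 1 by omega,
    show n + k + 1 - n = k + 1 by omega, Finset.sum_range_succ]

lemma branching_mul_profile_sub {n m : ℕ} (hn : 0 < n) (h : n ≤ m) :
    (T.branching m : ℝ) * (T.profile n (m + 1) - T.profile n m) =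
      T.profile n m - T.profile n (m - 1) := by
  obtain ⟨k, rfl⟩ := Nat.exists_eq_add_of_le h
  have hq := (T.branching_pos (n + k)).ne'
  rw [profile_add_succ, add_sub_cancel_left, Finset.prod_range_succ]
  cases k with
  | zero =>
    rw [Finset.prod_range_zero, one_mul, mul_inv_cancel₀ hq]
    rw [add_zero, profile_self, T.profile_of_lt (by omega), sub_zero]
  | succ k =>
    rw [mul_left_comm, mul_inv_cancel₀ hq, mul_one, ← add_assoc, Nat.add_sub_cancel,
      profile_add_succ, add_sub_cancel_left]

lemma profile_eq_one_add {n m : ℕ} (h : n ≤ m) :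
    T.profile n m = 1 + (T.branching n : ℝ)⁻¹ * T.profile (n + 1) m := by
  rw [profile, profile, show m + 1 - n = (m + 1 - (n + 1)) + 1 by omega, Finset.sum_range_succ',
    Finset.prod_range_zero, add_comm, Finset.mul_sum]
  refine congrArg _ (Finset.sum_congr rfl fun i _ => ?_)
  rw [Finset.prod_range_succ', mul_comm, add_zero]
  refine congrArg _ (Finset.prod_congr rfl fun l _ => ?_)
  rw [add_assoc, add_comm 1 l]

lemma profile_nonneg (n m : ℕ) : 0 ≤ T.profile n m := by
  unfold profile
  positivity

lemma one_le_profile {n m : ℕ} (h : n ≤ m) : 1 ≤ T.profile n m := by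
  rw [T.profile_eq_one_add h]
  have := mul_nonneg (inv_nonneg.2 (T.branching_pos n).le) (T.profile_nonneg (n + 1) m)
  linarith

lemma profile_le_two (n m : ℕ) : T.profile n m ≤ 2 := by
  refine le_trans (Finset.sum_le_sum (g := fun i => (1 / 2 : ℝ) ^ i) fun i _ => ?_)
    (sum_geometric_two_le _)
  rw [← Finset.card_range i, ← Finset.prod_const, Finset.card_range]
  refine Finset.prod_le_prod (fun _ _ => by positivity) fun l _ => ?_
  rw [one_div]
  exact inv_anti₀ two_pos (T.two_le_branching_real _)

lemma norm_profile_le_two (n m : ℕ) : ‖T.profile n m‖ ≤ 2 := by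
  rw [Real.norm_of_nonneg (T.profile_nonneg n m)]
  exact T.profile_le_two n m

lemma norm_profile_sq_le (n m : ℕ) : ‖T.profile n m ^ 2‖ ≤ 2 ^ 2 := by
  rw [norm_pow]
  gcongr
  exact T.norm_profile_le_two n m

/-- Summation by parts along the geodesic from the root to a vertex. -/
lemma sum_profile_mul_sub (n : ℕ) (b : ℕ → ℝ) (hb : b 0 = 0) :
    ∑ j ∈ Finset.range n, T.profile (j + 1) n * (b (j + 1) - (T.branching j : ℝ)⁻¹ * b j) =
      ∑ j ∈ Finset.range n, b (j + 1) := by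
  have h : ∀ j ∈ Finset.range n,
      T.profile (j + 1) n * (b (j + 1) - (T.branching j : ℝ)⁻¹ * b j) =
        (T.profile (j + 1) n * b (j + 1) - T.profile j n * b j) + b j := by
    intro j hj
    rw [T.profile_eq_one_add (Finset.mem_range.1 hj).le]
    ring
  rw [Finset.sum_congr rfl h, Finset.sum_add_distrib,
    Finset.sum_range_sub fun j => T.profile j n * b j, profile_self, hb]
  have h2 := (Finset.sum_range_succ b n).symm.trans (Finset.sum_range_succ' b n)
  linarith

/-- The function on the sector of `u` with the radial profile, extended by `0`. -/
def sectorProfile (u y : V) : ℝ :=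
  (T.sector u).indicator (fun y => T.profile (T.level u) (T.level y)) y

lemma sectorProfile_nonneg (u y : V) : 0 ≤ T.sectorProfile u y :=
  indicator_nonneg (fun _ _ => T.profile_nonneg _ _) _

lemma sectorProfile_le (u y : V) :
    T.sectorProfile u y ≤ (T.sector u).indicator (fun _ => 2) y :=
  indicator_le_indicator (T.profile_le_two _ _)

lemma sectorProfile_le_two (u y : V) : T.sectorProfile u y ≤ 2 :=
  (T.sectorProfile_le u y).trans (indicator_apply_le' (fun _ => le_rfl) fun _ => zero_le_two)

lemma norm_sectorProfile_le_two (u y : V) : ‖T.sectorProfile u y‖ ≤ 2 := by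
  rw [Real.norm_of_nonneg (T.sectorProfile_nonneg u y)]
  exact T.sectorProfile_le_two u y

/-- The outflow of a function at a vertex to its children minus the inflow from its parent.
Harmonic functions are those without excess flux. -/
def flux (f : V → ℝ) (x : V) : ℝ :=
  ∑ z ∈ T.children x, (f z - f x) - (f x - f (T.parent x))

lemma isHarmonic_iff_flux {f : V → ℝ} : T.IsHarmonic f ↔ ∀ x, T.flux f x = 0 := by
  simp_rw [isHarmonic_iff, flux, sub_eq_zero]

lemma flux_add (f g : V → ℝ) (x : V) : T.flux (fun y => f y + g y) x = T.flux f x + T.flux g x := by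
  simp only [flux, Finset.sum_sub_distrib, Finset.sum_add_distrib, Finset.sum_const]
  simp only [nsmul_eq_mul]
  ring

lemma flux_const_mul (c : ℝ) (f : V → ℝ) (x : V) :
    T.flux (fun y => c * f y) x = c * T.flux f x := by
  simp only [flux, ← mul_sub, ← Finset.mul_sum]

lemma flux_const (c : ℝ) (x : V) : T.flux (fun _ => c) x = 0 := by simp [flux]

lemma flux_sum {ι : Type*} (s : Finset ι) (f : ι → V → ℝ) (x : V) :
    T.flux (fun y => ∑ i ∈ s, f i y) x = ∑ i ∈ s, T.flux (f i) x := by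
  classical
  induction s using Finset.induction_on with
  | empty => simp [flux]
  | insert i s hi ih => simp_rw [Finset.sum_insert hi, flux_add, ih]

lemma sectorProfile_of_notMem {u y : V} (h : y ∉ T.sector u) : T.sectorProfile u y = 0 :=
  indicator_of_notMem h _

lemma sectorProfile_of_mem {u y : V} (h : y ∈ T.sector u) :
    T.sectorProfile u y = T.profile (T.level u) (T.level y) :=
  indicator_of_mem h _

open Classical in
/-- The function carried by the sector of `u` is harmonic except at the parent of `u`, where it
has unit flux. -/
lemma flux_sectorProfile {u : V} (hu : u ≠ T.root) (y : V) :
    T.flux (T.sectorProfile u) y = if y = T.parent u then 1 else 0 := by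
  have hpu : T.parent u ∉ T.sector u := fun h => by
    have h1 := T.level_le_of_mem_sector h
    have h2 := (T.parent_spec hu).2
    omega
  split_ifs with hy
  · subst hy
    have h1 : T.sectorProfile u (T.parent u) = 0 := T.sectorProfile_of_notMem hpu
    have h2 : T.sectorProfile u (T.parent (T.parent u)) = 0 :=
      T.sectorProfile_of_notMem fun h => hpu (T.mem_sector_of_parent_mem h)
    rw [flux, h1, h2, sub_zero, sub_zero, Finset.sum_eq_single u, sub_zero,
      T.sectorProfile_of_mem (T.self_mem_sector u), profile_self]
    · intro z hz hzu
      rw [sub_zero]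
      refine T.sectorProfile_of_notMem fun h => hzu ?_
      refine T.eq_of_mem_sector (T.self_mem_sector z) h ?_
      rw [T.level_of_mem_children hz, (T.parent_spec hu).2]
    · exact fun h => absurd (T.mem_children.2 ⟨hu, rfl⟩) h
  · by_cases hyu : y ∈ T.sector u
    · have h1 : ∀ z ∈ T.children y, T.sectorProfile u z - T.sectorProfile u y =
          T.profile (T.level u) (T.level y + 1) - T.profile (T.level u) (T.level y) := by
        intro z hz
        have hzu : z ∈ T.sector u :=
          T.mem_sector_of_parent_mem (by rwa [(T.mem_children.1 hz).2])
        rw [T.sectorProfile_of_mem hzu, T.sectorProfile_of_mem hyu, T.level_of_mem_children hz]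
      have h2 : T.sectorProfile u (T.parent y) = T.profile (T.level u) (T.level y - 1) := by
        by_cases hne : y = u
        · subst hne
          have := (T.parent_spec hu).2
          rw [T.sectorProfile_of_notMem hpu, T.profile_of_lt (by omega)]
        · rw [T.sectorProfile_of_mem (T.parent_mem_sector hyu hne), level_parent]
      rw [flux, Finset.sum_congr rfl h1, Finset.sum_const, card_children, nsmul_eq_mul,
        T.branching_mul_profile_sub (T.level_pos hu) (T.level_le_of_mem_sector hyu), h2,
        T.sectorProfile_of_mem hyu, sub_self]
    · have h1 : T.sectorProfile u y = 0 := T.sectorProfile_of_notMem hyu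
      have h2 : T.sectorProfile u (T.parent y) = 0 :=
        T.sectorProfile_of_notMem fun h => hyu (T.mem_sector_of_parent_mem h)
      rw [flux, h1, h2, sub_zero, sub_zero]
      refine Finset.sum_eq_zero fun z hz => ?_
      rw [sub_zero]
      refine T.sectorProfile_of_notMem fun h => ?_
      have hzp := (T.mem_children.1 hz).2
      by_cases hzu : z = u
      · exact hy (by rw [← hzp, hzu])
      · exact hyu (hzp ▸ T.parent_mem_sector h hzu)

/-- The function on the sector of `u`, minus the mean of the corresponding functions on the
sectors of `u` and its siblings. It is harmonic everywhere if `u` is not the root. -/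
def siblingDifference (u y : V) : ℝ :=
  T.sectorProfile u y - (T.branching (T.level (T.parent u)) : ℝ)⁻¹ *
    ∑ v ∈ T.children (T.parent u), T.sectorProfile v y

lemma flux_siblingDifference {u : V} (hu : u ≠ T.root) (y : V) :
    T.flux (T.siblingDifference u) y = 0 := by
  classical
  have h : T.siblingDifference u = fun y => T.sectorProfile u y +
      (-(T.branching (T.level (T.parent u)) : ℝ)⁻¹) *
        ∑ v ∈ T.children (T.parent u), T.sectorProfile v y := by
    funext y
    rw [siblingDifference, sub_eq_add_neg, neg_mul]
  rw [h, flux_add, flux_const_mul, flux_sum, Finset.sum_congr rfl fun v hv => by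
    rw [T.flux_sectorProfile (T.mem_children.1 hv).1, (T.mem_children.1 hv).2], Finset.sum_const,
    card_children, nsmul_eq_mul, T.flux_sectorProfile hu, ← mul_assoc, neg_mul,
    inv_mul_cancel₀ (T.branching_pos _).ne']
  ring

lemma norm_siblingDifference_le (u y : V) : ‖T.siblingDifference u y‖ ≤ 4 := by
  have hq := T.branching_pos (T.level (T.parent u))
  have h : ‖∑ v ∈ T.children (T.parent u), T.sectorProfile v y‖ ≤
      T.branching (T.level (T.parent u)) * 2 := by
    rw [← card_children, ← nsmul_eq_mul]
    exact norm_sum_le_of_le _ (fun v _ => T.norm_sectorProfile_le_two v y) |>.trans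
      (by rw [Finset.sum_const])
  calc ‖T.siblingDifference u y‖ ≤ ‖T.sectorProfile u y‖ +
        ‖(T.branching (T.level (T.parent u)) : ℝ)⁻¹ *
          ∑ v ∈ T.children (T.parent u), T.sectorProfile v y‖ := norm_sub_le _ _
    _ ≤ 2 + (T.branching (T.level (T.parent u)) : ℝ)⁻¹ *
          (T.branching (T.level (T.parent u)) * 2) := by
        rw [norm_mul, Real.norm_of_nonneg (inv_nonneg.2 hq.le)]
        gcongr
        exact T.norm_sectorProfile_le_two u y
    _ = 4 := by
        rw [inv_mul_cancel_left₀ hq.ne']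
        norm_num

lemma enorm_sectorProfile_le (u y : V) :
    ‖T.sectorProfile u y‖ₑ ≤ 2 * (T.sector u).indicator (fun _ => 1) y := by
  by_cases h : y ∈ T.sector u
  · rw [indicator_of_mem h, mul_one, Real.enorm_of_nonneg (T.sectorProfile_nonneg u y)]
    exact (ENNReal.ofReal_le_ofReal (T.sectorProfile_le_two u y)).trans (by simp)
  · rw [T.sectorProfile_of_notMem h, enorm_zero]
    exact zero_le

lemma enorm_branching_inv (n : ℕ) : ‖(T.branching n : ℝ)⁻¹‖ₑ = (T.branching n : ℝ≥0∞)⁻¹ := by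
  rw [Real.enorm_of_nonneg (inv_nonneg.2 (T.branching_pos n).le),
    ENNReal.ofReal_inv_of_pos (T.branching_pos n), ENNReal.ofReal_natCast]

lemma enorm_siblingDifference_le (u y : V) :
    ‖T.siblingDifference u y‖ₑ ≤ 2 * ((T.sector u).indicator (fun _ => 1) y +
      (T.branching (T.level (T.parent u)) : ℝ≥0∞)⁻¹ *
        ∑ v ∈ T.children (T.parent u), (T.sector v).indicator (fun _ => 1) y) := by
  calc ‖T.siblingDifference u y‖ₑ ≤ ‖T.sectorProfile u y‖ₑ +
        ‖(T.branching (T.level (T.parent u)) : ℝ)⁻¹ *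
          ∑ v ∈ T.children (T.parent u), T.sectorProfile v y‖ₑ := enorm_sub_le
    _ ≤ 2 * (T.sector u).indicator (fun _ => 1) y +
        (T.branching (T.level (T.parent u)) : ℝ≥0∞)⁻¹ *
          ∑ v ∈ T.children (T.parent u), 2 * (T.sector v).indicator (fun _ => 1) y := by
        rw [enorm_mul, enorm_branching_inv]
        gcongr
        · exact T.enorm_sectorProfile_le u y
        · exact (enorm_sum_le _ _).trans
            (Finset.sum_le_sum fun v _ => T.enorm_sectorProfile_le v y)
    _ = _ := by
        rw [← Finset.mul_sum]
        ring

/-! ### Generation sums of harmonic functions -/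

/-- The flux of a harmonic function through each generation of a sector is the inflow at its
vertex. -/
lemma sum_generation_sub_parent {f : V → ℝ} (hf : T.IsHarmonic f) (u : V) (k : ℕ) :
    ∑ y ∈ T.generation u k, (f y - f (T.parent y)) = f u - f (T.parent u) := by
  induction k with
  | zero => simp [generation]
  | succ k ih =>
    rw [sum_generation_succ, ← ih]
    refine Finset.sum_congr rfl fun y _ => ?_
    rw [← T.isHarmonic_iff.1 hf y]
    exact Finset.sum_congr rfl fun z hz => by rw [(T.mem_children.1 hz).2]

/-- Over each generation of the sector of `u`, a harmonic function has the same sum as the radial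
solution with the same values at `u` and at its parent. -/
lemma sum_generation_harmonic {f : V → ℝ} (hf : T.IsHarmonic f) (u : V) (k : ℕ) :
    ∑ y ∈ T.generation u k, f y = ∑ y ∈ T.generation u k,
      (f (T.parent u) + (f u - f (T.parent u)) * T.profile (T.level u) (T.level y)) := by
  have hcongr : ∀ j, ∑ y ∈ T.generation u j,
      (f (T.parent u) + (f u - f (T.parent u)) * T.profile (T.level u) (T.level y)) =
      (∏ i ∈ Finset.range j, (T.branching (T.level u + i) : ℝ)) *
        (f (T.parent u) + (f u - f (T.parent u)) * T.profile (T.level u) (T.level u + j)) := by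
    intro j
    rw [Finset.sum_congr rfl fun y hy => by rw [T.level_of_mem_generation hy], Finset.sum_const,
      nsmul_eq_mul, card_generation]
  rw [hcongr]
  induction k with
  | zero => simp [generation, profile_self]
  | succ k ih =>
    have h := T.sum_generation_sub_parent hf u (k + 1)
    have hpar : ∑ y ∈ T.generation u k, ∑ z ∈ T.children y, f (T.parent z) =
        (T.branching (T.level u + k) : ℝ) * ∑ y ∈ T.generation u k, f y := by
      rw [Finset.mul_sum]
      refine Finset.sum_congr rfl fun y hy => ?_
      rw [Finset.sum_congr rfl fun z hz => by rw [(T.mem_children.1 hz).2], Finset.sum_const,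
        card_children, nsmul_eq_mul, T.level_of_mem_generation hy]
    rw [Finset.sum_sub_distrib, T.sum_generation_succ u k fun y => f (T.parent y), hpar, ih] at h
    rw [sub_eq_iff_eq_add.1 h, ← add_assoc, profile_add_succ, Finset.prod_inv_distrib]
    have hP := mul_inv_cancel₀ (Finset.prod_ne_zero_iff.2 fun i (_ : i ∈ Finset.range (k + 1)) =>
      (T.branching_pos (T.level u + i)).ne')
    rw [Finset.prod_range_succ] at hP ⊢
    linear_combination (f (T.parent u) - f u) * hP

/-! ### The mass of generations and sectors -/

/-- The total mass of the `k`-th generation of descendants of a vertex at level `n`. -/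
def generationMass (α : ℝ) (n k : ℕ) : ℝ :=
  (∏ l ∈ Finset.range (n + k), 1 / (T.branching l : ℝ) ^ α) *
    ∏ i ∈ Finset.range k, (T.branching (n + i) : ℝ)

lemma generationMass_nonneg (α : ℝ) (n k : ℕ) : 0 ≤ T.generationMass α n k := by
  unfold generationMass
  positivity

lemma generationMass_succ_le {α : ℝ} (hα : 1 < α) (n k : ℕ) :
    T.generationMass α n (k + 1) ≤ (2 : ℝ) ^ (1 - α) * T.generationMass α n k := by
  have hq := T.branching_pos (n + k)
  have h : T.generationMass α n (k + 1) =
      (T.branching (n + k) : ℝ) ^ (1 - α) * T.generationMass α n k := by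
    unfold generationMass
    rw [← add_assoc, Finset.prod_range_succ, Finset.prod_range_succ, Real.rpow_sub hq,
      Real.rpow_one]
    ring
  rw [h]
  refine mul_le_mul_of_nonneg_right ?_ (T.generationMass_nonneg α n k)
  exact Real.rpow_le_rpow_of_nonpos two_pos (T.two_le_branching_real _) (by linarith)

lemma generationMass_add_le {α : ℝ} (hα : 1 < α) (n k m : ℕ) :
    T.generationMass α n (k + m) ≤ ((2 : ℝ) ^ (1 - α)) ^ m * T.generationMass α n k := by
  induction m with
  | zero => simp
  | succ m ih =>
    refine (T.generationMass_succ_le hα n (k + m)).trans ?_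
    rw [pow_succ', mul_assoc]
    gcongr

lemma summable_generationMass {α : ℝ} (hα : 1 < α) (n : ℕ) :
    Summable (T.generationMass α n) := by
  have hr : (2 : ℝ) ^ (1 - α) < 1 := Real.rpow_lt_one_of_one_lt_of_neg one_lt_two (by linarith)
  refine Summable.of_nonneg_of_le (T.generationMass_nonneg α n) (fun k => ?_)
    ((summable_geometric_of_lt_one (by positivity) hr).mul_right (T.generationMass α n 0))
  have := T.generationMass_add_le hα n 0 k
  rwa [zero_add] at this

lemma weight_of_mem_generation (α : ℝ) {x y : V} {k : ℕ} (h : y ∈ T.generation x k) :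
    T.weight α y = ∏ l ∈ Finset.range (T.level x + k), 1 / (T.branching l : ℝ) ^ α := by
  rw [weight, T.level_of_mem_generation h]

variable [MeasurableSpace V] [DiscreteMeasurableSpace V]

lemma measure_generation (α : ℝ) (x : V) (k : ℕ) :
    T.measure α (T.generation x k) = ENNReal.ofReal (T.generationMass α (T.level x) k) := by
  rw [← sum_measure_singleton, Finset.sum_congr rfl fun y hy => by
    rw [measure_singleton, T.weight_of_mem_generation α hy], Finset.sum_const, nsmul_eq_mul,
    ← ENNReal.ofReal_natCast, card_generation, ← ENNReal.ofReal_mul (by positivity), mul_comm,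
    generationMass]

lemma measure_sector (α : ℝ) (x : V) :
    T.measure α (T.sector x) = ∑' k, ENNReal.ofReal (T.generationMass α (T.level x) k) := by
  rw [← T.iUnion_generation, measure_iUnion (T.pairwise_disjoint_generation x)
    fun _ => MeasurableSet.of_discrete]
  simp_rw [T.measure_generation]

lemma measure_sector_congr (α : ℝ) {x y : V} (h : T.level x = T.level y) :
    T.measure α (T.sector x) = T.measure α (T.sector y) := by
  rw [measure_sector, measure_sector, h]

lemma isFiniteMeasure_measure {α : ℝ} (hα : 1 < α) : IsFiniteMeasure (T.measure α) := by
  refine ⟨?_⟩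
  rw [← T.sector_root, measure_sector]
  exact (T.summable_generationMass hα _).tsum_ofReal_lt_top

lemma measure_sector_pos (α : ℝ) (x : V) : 0 < T.measure α (T.sector x) := by
  refine lt_of_lt_of_le ?_ (measure_mono (singleton_subset_iff.2 (T.self_mem_sector x)))
  rw [measure_singleton, ENNReal.ofReal_pos]
  exact T.weight_pos α x

/-- The mass of the generations decays geometrically, so a bounded number of generations carries
half of the mass of a sector. -/
lemma half_measure_sector_le {α : ℝ} (hα : 1 < α) {m : ℕ}
    (hm : ((2 : ℝ) ^ (1 - α)) ^ m ≤ 1 / 2) (x : V) :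
    T.measure α (T.sector x) / 2 ≤
      T.measure α {y | y ∈ T.sector x ∧ T.level y < T.level x + m} := by
  have := T.isFiniteMeasure_measure hα
  set E := {y | y ∈ T.sector x ∧ T.level y < T.level x + m}
  set S := T.sector x
  have htail : T.measure α (S \ E) ≤ T.measure α S / 2 := by
    have hsub : S \ E ⊆ ⋃ k, (T.generation x (k + m) : Set V) := by
      rintro y ⟨hy, hyE⟩
      have hl : T.level x + m ≤ T.level y := not_lt.1 fun h => hyE ⟨hy, h⟩
      refine mem_iUnion.2 ⟨T.level y - T.level x - m, ?_⟩
      rw [Finset.mem_coe, mem_generation]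
      exact ⟨hy, by omega⟩
    calc T.measure α (S \ E) ≤ ∑' k, T.measure α (T.generation x (k + m)) :=
          (measure_mono hsub).trans (measure_iUnion_le _)
      _ ≤ ∑' k, ENNReal.ofReal (1 / 2) * ENNReal.ofReal (T.generationMass α (T.level x) k) := by
          refine ENNReal.tsum_le_tsum fun k => ?_
          rw [measure_generation, ← ENNReal.ofReal_mul (by norm_num)]
          refine ENNReal.ofReal_le_ofReal ((T.generationMass_add_le hα _ _ _).trans ?_)
          exact mul_le_mul_of_nonneg_right hm (T.generationMass_nonneg _ _ _)
      _ = T.measure α S / 2 := by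
          rw [ENNReal.tsum_mul_left, ← measure_sector, one_div,
            ENNReal.ofReal_inv_of_pos two_pos, ENNReal.ofReal_ofNat, ENNReal.div_eq_inv_mul]
  have hsplit : T.measure α S = T.measure α E + T.measure α (S \ E) := by
    rw [measure_add_sdiff MeasurableSet.of_discrete.nullMeasurableSet,
      union_eq_self_of_subset_left (show E ⊆ S from fun y hy => hy.1)]
  have h2 : T.measure α S / 2 + T.measure α S / 2 ≤ T.measure α E + T.measure α S / 2 := by
    rw [ENNReal.add_halves]
    exact hsplit.le.trans (by gcongr)
  exact ENNReal.le_of_add_le_add_right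
    (ENNReal.div_ne_top (measure_ne_top _ _) two_ne_zero) h2

/-! ### Integrals over sectors -/

lemma hasSum_setIntegral_sector (α : ℝ) {x : V} {f : V → ℝ}
    (hf : IntegrableOn f (T.sector x) (T.measure α)) :
    HasSum (fun k => (∏ l ∈ Finset.range (T.level x + k), 1 / (T.branching l : ℝ) ^ α) *
      ∑ y ∈ T.generation x k, f y) (∫ y in T.sector x, f y ∂(T.measure α)) := by
  rw [← T.iUnion_generation] at hf ⊢
  have h := hasSum_integral_iUnion (fun _ => MeasurableSet.of_discrete)
    (T.pairwise_disjoint_generation x) hf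
  have hgen : ∀ k, ∫ y in (T.generation x k : Set V), f y ∂(T.measure α) =
      (∏ l ∈ Finset.range (T.level x + k), 1 / (T.branching l : ℝ) ^ α) *
        ∑ y ∈ T.generation x k, f y := by
    intro k
    rw [setIntegral_finset _ (hf.mono_set (subset_iUnion (fun k => (T.generation x k : Set V)) k)),
      Finset.mul_sum]
    refine Finset.sum_congr rfl fun y hy => ?_
    rw [real_singleton, T.weight_of_mem_generation α hy, smul_eq_mul]
  simpa only [hgen] using h

/-- The weight is radial, so an integral over a sector only depends on the sums of the integrand
over the generations. -/
lemma setIntegral_sector_congr (α : ℝ) {x : V} {f g : V → ℝ}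
    (hf : IntegrableOn f (T.sector x) (T.measure α))
    (hg : IntegrableOn g (T.sector x) (T.measure α))
    (h : ∀ k, ∑ y ∈ T.generation x k, f y = ∑ y ∈ T.generation x k, g y) :
    ∫ y in T.sector x, f y ∂(T.measure α) = ∫ y in T.sector x, g y ∂(T.measure α) := by
  refine (T.hasSum_setIntegral_sector α hf).unique ?_
  simp_rw [h]
  exact T.hasSum_setIntegral_sector α hg

lemma setIntegral_sector_radial (α : ℝ) {x x' : V} (hl : T.level x = T.level x') {g : ℕ → ℝ}
    (hg : Integrable (fun y => g (T.level y)) (T.measure α)) :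
    ∫ y in T.sector x, g (T.level y) ∂(T.measure α) =
      ∫ y in T.sector x', g (T.level y) ∂(T.measure α) := by
  refine (T.hasSum_setIntegral_sector α hg.integrableOn).unique ?_
  convert T.hasSum_setIntegral_sector α (x := x') hg.integrableOn using 2 with k
  have key : ∀ z : V, ∑ y ∈ T.generation z k, g (T.level y) =
      (∏ i ∈ Finset.range k, (T.branching (T.level z + i) : ℝ)) * g (T.level z + k) := by
    intro z
    rw [Finset.sum_congr rfl fun y hy => by rw [T.level_of_mem_generation hy], Finset.sum_const,
      nsmul_eq_mul, card_generation]
  rw [key, key, hl]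

/-! ### The kernel of the Bergman projector -/

lemma aestronglyMeasurable_of_discrete (α : ℝ) (f : V → ℝ) :
    AEStronglyMeasurable f (T.measure α) :=
  (Measurable.of_discrete (f := f)).aestronglyMeasurable

lemma integrable_of_norm_le {α : ℝ} (hα : 1 < α) {f : V → ℝ} {c : ℝ} (h : ∀ y, ‖f y‖ ≤ c) :
    Integrable f (T.measure α) := by
  have := T.isFiniteMeasure_measure hα
  exact Integrable.of_bound (T.aestronglyMeasurable_of_discrete α f) c (ae_of_all _ h)

lemma integrable_mul_of_norm_le {α : ℝ} {f g : V → ℝ} {c : ℝ} (hg : ∀ y, ‖g y‖ ≤ c)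
    (hf : Integrable f (T.measure α)) : Integrable (fun y => g y * f y) (T.measure α) :=
  hf.bdd_mul (T.aestronglyMeasurable_of_discrete α g) (ae_of_all _ hg)

/-- The squared `L²` norm of the function with the radial profile on the sector of `u`. -/
def profileMass (α : ℝ) (u : V) : ℝ :=
  ∫ y in T.sector u, T.profile (T.level u) (T.level y) ^ 2 ∂(T.measure α)

lemma profileMass_congr {α : ℝ} (hα : 1 < α) {u v : V} (h : T.level u = T.level v) :
    T.profileMass α u = T.profileMass α v := by
  rw [profileMass, profileMass, ← h]
  exact T.setIntegral_sector_radial α h (g := fun m => T.profile (T.level u) m ^ 2)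
    (T.integrable_of_norm_le hα fun y => T.norm_profile_sq_le _ _)

lemma measure_sector_le_profileMass {α : ℝ} (hα : 1 < α) (u : V) :
    (T.measure α).real (T.sector u) ≤ T.profileMass α u := by
  have := T.isFiniteMeasure_measure hα
  calc (T.measure α).real (T.sector u) = ∫ _ in T.sector u, 1 ∂(T.measure α) := by simp
    _ ≤ T.profileMass α u := by
      refine setIntegral_mono_on (integrable_const _).integrableOn
        (T.integrable_of_norm_le hα fun y => T.norm_profile_sq_le _ _).integrableOn
        MeasurableSet.of_discrete fun y hy => ?_
      exact one_le_pow₀ (T.one_le_profile (T.level_le_of_mem_sector hy))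

lemma real_sector_pos {α : ℝ} (hα : 1 < α) (u : V) : 0 < (T.measure α).real (T.sector u) := by
  have := T.isFiniteMeasure_measure hα
  exact ENNReal.toReal_pos (T.measure_sector_pos α u).ne' (measure_ne_top _ _)

lemma profileMass_pos {α : ℝ} (hα : 1 < α) (u : V) : 0 < T.profileMass α u :=
  (T.real_sector_pos hα u).trans_le (T.measure_sector_le_profileMass hα u)

lemma integral_sectorProfile_mul {α : ℝ} (hα : 1 < α) {f : V → ℝ} (hf : T.IsHarmonic f)
    (hfi : Integrable f (T.measure α)) (u : V) :
    ∫ y, T.sectorProfile u y * f y ∂(T.measure α) =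
      f (T.parent u) * ∫ y in T.sector u, T.profile (T.level u) (T.level y) ∂(T.measure α) +
        (f u - f (T.parent u)) * T.profileMass α u := by
  have h1 : (fun y => T.sectorProfile u y * f y) =
      (T.sector u).indicator fun y => T.profile (T.level u) (T.level y) * f y := by
    funext y
    exact (indicator_mul_left _ _ _).symm
  have hi1 : Integrable (fun y => T.profile (T.level u) (T.level y)) (T.measure α) :=
    T.integrable_of_norm_le hα fun y => T.norm_profile_le_two _ _
  have hi2 : Integrable (fun y => T.profile (T.level u) (T.level y) ^ 2) (T.measure α) :=
    T.integrable_of_norm_le hα fun y => T.norm_profile_sq_le _ _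
  have hi3 : Integrable (fun y => f (T.parent u) * T.profile (T.level u) (T.level y) +
      (f u - f (T.parent u)) * T.profile (T.level u) (T.level y) ^ 2) (T.measure α) :=
    (hi1.const_mul _).add (hi2.const_mul _)
  rw [h1, integral_indicator MeasurableSet.of_discrete, profileMass,
    T.setIntegral_sector_congr α
      (T.integrable_mul_of_norm_le (fun y => T.norm_profile_le_two _ _) hfi).integrableOn
      hi3.integrableOn,
    integral_add (hi1.const_mul _).integrableOn (hi2.const_mul _).integrableOn,
    integral_const_mul, integral_const_mul]
  intro k
  have hsum := congrArg (fun s => T.profile (T.level u) (T.level u + k) * s)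
    (T.sum_generation_harmonic hf u k)
  simp only [Finset.mul_sum] at hsum
  rw [Finset.sum_congr rfl fun y hy => by rw [T.level_of_mem_generation hy], hsum]
  refine Finset.sum_congr rfl fun y hy => ?_
  rw [T.level_of_mem_generation hy]
  ring

lemma integral_of_isHarmonic {α : ℝ} (hα : 1 < α) {f : V → ℝ} (hf : T.IsHarmonic f)
    (hfi : Integrable f (T.measure α)) :
    ∫ y, f y ∂(T.measure α) = (T.measure α).real univ * f T.root := by
  have := T.isFiniteMeasure_measure hα
  rw [← setIntegral_univ, ← T.sector_root,
    T.setIntegral_sector_congr α (g := fun _ => f T.root) hfi.integrableOn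
      (integrable_const _).integrableOn, setIntegral_const, smul_eq_mul]
  intro k
  rw [T.sum_generation_harmonic hf]
  refine Finset.sum_congr rfl fun y _ => ?_
  rw [parent_root, sub_self, zero_mul, add_zero]

lemma integral_siblingDifference_mul {α : ℝ} (hα : 1 < α) {f : V → ℝ} (hf : T.IsHarmonic f)
    (hfi : Integrable f (T.measure α)) {u : V} (hu : u ≠ T.root) :
    ∫ y, T.siblingDifference u y * f y ∂(T.measure α) =
      T.profileMass α u * ((f u - f (T.parent u)) -
        (T.branching (T.level (T.parent u)) : ℝ)⁻¹ *
          (f (T.parent u) - f (T.parent (T.parent u)))) := by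
  have hint : ∀ v, Integrable (fun y => T.sectorProfile v y * f y) (T.measure α) := fun v =>
    T.integrable_mul_of_norm_le (T.norm_sectorProfile_le_two v) hfi
  have hq := (T.branching_pos (T.level (T.parent u))).ne'
  have h : ∀ y, T.siblingDifference u y * f y = T.sectorProfile u y * f y -
      (T.branching (T.level (T.parent u)) : ℝ)⁻¹ *
        ∑ v ∈ T.children (T.parent u), T.sectorProfile v y * f y := by
    intro y
    rw [siblingDifference, sub_mul, mul_assoc, Finset.sum_mul]
  have hv : ∀ v ∈ T.children (T.parent u), ∫ y, T.sectorProfile v y * f y ∂(T.measure α) =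
      f (T.parent u) * ∫ y in T.sector u, T.profile (T.level u) (T.level y) ∂(T.measure α) +
        (f v - f (T.parent u)) * T.profileMass α u := by
    intro v hv
    have hl := T.level_of_mem_siblings hu hv
    rw [T.integral_sectorProfile_mul hα hf hfi, (T.mem_children.1 hv).2,
      T.profileMass_congr hα hl, hl,
      T.setIntegral_sector_radial α hl (g := fun m => T.profile (T.level u) m)
        (T.integrable_of_norm_le hα fun y => T.norm_profile_le_two _ _)]
  simp_rw [h]
  rw [integral_sub (hint u) ((integrable_finsetSum _ fun v _ => hint v).const_mul _),
    integral_const_mul, integral_finsetSum _ fun v _ => hint v, Finset.sum_congr rfl hv,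
    Finset.sum_add_distrib, Finset.sum_const, card_children, nsmul_eq_mul, ← Finset.sum_mul,
    T.isHarmonic_iff.1 hf, T.integral_sectorProfile_mul hα hf hfi]
  field_simp
  ring

/-- The reproducing kernel of the Bergman space, written out as the kernel of the projection onto
the constants plus, for each ancestor `u ≠ root` of `x`, a multiple of the harmonic function
carried by the sectors of `u` and its siblings. -/
def explicitKernel (α : ℝ) (x y : V) : ℝ :=
  ((T.measure α).real univ)⁻¹ + ∑ j ∈ Finset.range (T.level x),
    T.profile (j + 1) (T.level x) / T.profileMass α (T.ancestor x (j + 1)) *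
      T.siblingDifference (T.ancestor x (j + 1)) y

set_option linter.unusedSectionVars false in
lemma isHarmonic_explicitKernel (α : ℝ) (x : V) : T.IsHarmonic (T.explicitKernel α x) := by
  rw [isHarmonic_iff_flux]
  intro y
  unfold explicitKernel
  rw [flux_add, flux_const, flux_sum, zero_add]
  refine Finset.sum_eq_zero fun j hj => ?_
  rw [flux_const_mul, T.flux_siblingDifference
    (T.ancestor_succ_ne_root (Finset.mem_range.1 hj)), mul_zero]

set_option linter.unusedSectionVars false in
lemma exists_norm_explicitKernel_le (α : ℝ) (x : V) : ∃ c, ∀ y, ‖T.explicitKernel α x y‖ ≤ c := by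
  refine ⟨_, fun y => (norm_add_le _ _).trans (add_le_add_right (norm_sum_le_of_le _
    (fun j _ => (norm_mul_le _ _).trans
      (mul_le_mul_of_nonneg_left (T.norm_siblingDifference_le _ y) (norm_nonneg _)))) _)⟩

lemma integral_explicitKernel_mul {α : ℝ} (hα : 1 < α) {f : V → ℝ} (hf : T.IsHarmonic f)
    (hfi : Integrable f (T.measure α)) (x : V) :
    ∫ y, T.explicitKernel α x y * f y ∂(T.measure α) = f x := by
  have hμ : (T.measure α).real univ ≠ 0 := by
    rw [← T.sector_root]
    exact (T.real_sector_pos hα T.root).ne'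
  have hint : ∀ j, Integrable (fun y => T.profile (j + 1) (T.level x) /
      T.profileMass α (T.ancestor x (j + 1)) *
        (T.siblingDifference (T.ancestor x (j + 1)) y * f y)) (T.measure α) := fun j =>
    (T.integrable_mul_of_norm_le (T.norm_siblingDifference_le _) hfi).const_mul _
  have h : ∀ y, T.explicitKernel α x y * f y = ((T.measure α).real univ)⁻¹ * f y +
      ∑ j ∈ Finset.range (T.level x), T.profile (j + 1) (T.level x) /
        T.profileMass α (T.ancestor x (j + 1)) *
          (T.siblingDifference (T.ancestor x (j + 1)) y * f y) := by
    intro y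
    simp_rw [explicitKernel, add_mul, Finset.sum_mul, mul_assoc]
  simp_rw [h]
  rw [integral_add (hfi.const_mul _) (integrable_finsetSum _ fun j _ => hint j),
    integral_const_mul, integral_finsetSum _ fun j _ => hint j,
    T.integral_of_isHarmonic hα hf hfi, inv_mul_cancel_left₀ hμ]
  have hterm : ∀ j ∈ Finset.range (T.level x), ∫ y, T.profile (j + 1) (T.level x) /
      T.profileMass α (T.ancestor x (j + 1)) *
        (T.siblingDifference (T.ancestor x (j + 1)) y * f y) ∂(T.measure α) =
      T.profile (j + 1) (T.level x) *
        ((f (T.ancestor x (j + 1)) - f (T.parent (T.ancestor x (j + 1)))) -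
          (T.branching j : ℝ)⁻¹ * (f (T.ancestor x j) - f (T.parent (T.ancestor x j)))) := by
    intro j hj
    have hj' := Finset.mem_range.1 hj
    rw [integral_const_mul, T.integral_siblingDifference_mul hα hf hfi
      (T.ancestor_succ_ne_root hj'), T.parent_ancestor_succ hj', T.level_ancestor hj'.le,
      ← mul_assoc, div_mul_cancel₀ _ (T.profileMass_pos hα _).ne']
  rw [Finset.sum_congr rfl hterm, T.sum_profile_mul_sub (T.level x)
    fun j => f (T.ancestor x j) - f (T.parent (T.ancestor x j))]
  · rw [Finset.sum_congr rfl fun j hj => by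
      rw [T.parent_ancestor_succ (Finset.mem_range.1 hj)],
      Finset.sum_range_sub fun j => f (T.ancestor x j), ancestor_level, ancestor_zero]
    ring
  · rw [ancestor_zero, parent_root, sub_self]

/-- The explicit kernel is harmonic and reproduces harmonic functions, so it is the kernel of the
orthogonal projection. -/
lemma bergmanKernel_eq {α : ℝ} (hα : 1 < α) (x : V) :
    T.bergmanKernel α x = T.explicitKernel α x := by
  have := T.isFiniteMeasure_measure hα
  obtain ⟨c, hc⟩ := T.exists_norm_explicitKernel_le α x
  have hk : MemLp (T.explicitKernel α x) 2 (T.measure α) :=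
    MemLp.of_bound (T.aestronglyMeasurable_of_discrete α _) c (ae_of_all _ hc)
  have hcoe : (hk.toLp : V → ℝ) = T.explicitKernel α x := T.eq_of_ae_eq hk.coeFn_toLp
  have hproj : T.bergmanProjL2 α (T.evalVec α x) = hk.toLp := by
    refine Submodule.eq_starProjection_of_mem_of_inner_eq_zero ?_ fun f hf => ?_
    · change T.IsHarmonic (hk.toLp : V → ℝ)
      rw [hcoe]
      exact T.isHarmonic_explicitKernel α x
    · have hfi : Integrable f (T.measure α) := (Lp.memLp f).integrable one_le_two
      rw [inner_sub_left, inner_evalVec, L2.inner_def, hcoe, sub_eq_zero,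
        ← T.integral_explicitKernel_mul hα hf hfi x]
      refine integral_congr_ae (ae_of_all _ fun y => ?_)
      simp [mul_comm]
  funext y
  rw [bergmanKernel, hproj, hcoe]

/-! ### The size of the kernel -/

lemma enorm_profile_div_le {α : ℝ} (hα : 1 < α) (n m : ℕ) (u : V) :
    ‖T.profile n m / T.profileMass α u‖ₑ ≤ 2 * (T.measure α (T.sector u))⁻¹ := by
  have := T.isFiniteMeasure_measure hα
  have h : T.profile n m / T.profileMass α u ≤ 2 * ((T.measure α).real (T.sector u))⁻¹ := by
    rw [div_eq_mul_inv]
    exact mul_le_mul (T.profile_le_two n m)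
      (inv_anti₀ (T.real_sector_pos hα u) (T.measure_sector_le_profileMass hα u))
      (inv_nonneg.2 (T.profileMass_pos hα u).le) zero_le_two
  rw [Real.enorm_of_nonneg (div_nonneg (T.profile_nonneg n m) (T.profileMass_pos hα u).le)]
  refine (ENNReal.ofReal_le_ofReal h).trans ?_
  rw [ENNReal.ofReal_mul zero_le_two, ENNReal.ofReal_inv_of_pos (T.real_sector_pos hα u),
    ofReal_measureReal, ENNReal.ofReal_ofNat]

/-- The kernel is dominated by a diagonal part, over the sectors which contain both points, and an
off-diagonal part, over the pairs of siblings which have one of the points each in their sectors.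
The masses of the sectors of siblings agree. -/
lemma enorm_bergmanKernel_le {α : ℝ} (hα : 1 < α) (x y : V) :
    ‖T.bergmanKernel α x y‖ₑ ≤ 4 *
      (∑' u, (T.sector u).indicator (fun _ => 1) x *
          ((T.measure α (T.sector u))⁻¹ * (T.sector u).indicator (fun _ => 1) y) +
        ∑' v : {v // v ≠ T.root}, (∑' z : {z : V // z ≠ T.root ∧ T.parent z = T.parent v},
            (T.sector z).indicator (fun _ => 1) x) *
          ((T.numChildren (T.parent v) : ℝ≥0∞)⁻¹ *
            ((T.measure α (T.sector v))⁻¹ * (T.sector v).indicator (fun _ => 1) y))) := by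
  have := T.isFiniteMeasure_measure hα
  rw [T.bergmanKernel_eq hα, explicitKernel]
  have hconst : ‖((T.measure α).real univ)⁻¹‖ₑ ≤ 4 * ((T.measure α (T.sector T.root))⁻¹ *
      (T.sector T.root).indicator (fun _ => 1) y) := by
    have hpos := T.real_sector_pos hα T.root
    rw [sector_root] at hpos ⊢
    rw [indicator_univ, mul_one, Real.enorm_of_nonneg (inv_nonneg.2 hpos.le),
      ENNReal.ofReal_inv_of_pos hpos, ofReal_measureReal]
    exact le_mul_of_one_le_left zero_le (by norm_num)
  have hterm : ∀ j ∈ Finset.range (T.level x),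
      ‖T.profile (j + 1) (T.level x) / T.profileMass α (T.ancestor x (j + 1)) *
        T.siblingDifference (T.ancestor x (j + 1)) y‖ₑ ≤
      4 * ((T.measure α (T.sector (T.ancestor x (j + 1))))⁻¹ *
          (T.sector (T.ancestor x (j + 1))).indicator (fun _ => 1) y) +
        4 * ∑ v ∈ T.children (T.ancestor x j), (T.numChildren (T.parent v) : ℝ≥0∞)⁻¹ *
          ((T.measure α (T.sector v))⁻¹ * (T.sector v).indicator (fun _ => 1) y) := by
    intro j hj
    have hj' := Finset.mem_range.1 hj
    rw [enorm_mul]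
    refine (mul_le_mul' (T.enorm_profile_div_le hα _ _ _)
      (T.enorm_siblingDifference_le _ _)).trans (le_of_eq ?_)
    have hv : ∀ v ∈ T.children (T.ancestor x j), (T.numChildren (T.parent v) : ℝ≥0∞)⁻¹ *
        ((T.measure α (T.sector v))⁻¹ * (T.sector v).indicator (fun _ => 1) y) =
        (T.branching (T.level (T.ancestor x j)) : ℝ≥0∞)⁻¹ *
          (T.measure α (T.sector (T.ancestor x (j + 1))))⁻¹ *
            (T.sector v).indicator (fun _ => 1) y := by
      intro v hv
      rw [(T.mem_children.1 hv).2, numChildren, mul_assoc, T.measure_sector_congr α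
        ((T.level_of_mem_children hv).trans
          (T.level_of_mem_children (T.ancestor_succ_mem_children hj')).symm)]
    rw [Finset.sum_congr rfl hv, ← Finset.mul_sum, T.parent_ancestor_succ hj']
    ring
  refine (enorm_add_le _ _).trans ((add_le_add hconst ((enorm_sum_le _ _).trans
    (Finset.sum_le_sum hterm))).trans ?_)
  rw [Finset.sum_add_distrib, ← Finset.mul_sum, ← Finset.mul_sum, ← add_assoc, ← mul_add,
    ← mul_add]
  gcongr
  · refine le_trans (le_of_eq ?_) (T.sum_ancestor_le_tsum x fun u =>
      (T.measure α (T.sector u))⁻¹ * (T.sector u).indicator (fun _ => 1) y)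
    rw [Finset.sum_range_succ', ancestor_zero, add_comm]
  · exact T.sum_siblings_le_tsum x fun v => (T.numChildren (T.parent v) : ℝ≥0∞)⁻¹ *
      ((T.measure α (T.sector v))⁻¹ * (T.sector v).indicator (fun _ => 1) y)

/-! ### Domination by forms over all sectors -/

lemma lintegral_indicator_sector_mul (α : ℝ) (u : V) (f : V → ℝ) :
    ∫⁻ y, (T.sector u).indicator (fun _ => 1) y * ‖f y‖ₑ ∂(T.measure α) =
      ∫⁻ y in T.sector u, ‖f y‖ₑ ∂(T.measure α) := by
  rw [← lintegral_indicator MeasurableSet.of_discrete]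
  refine lintegral_congr fun y => ?_
  by_cases h : y ∈ T.sector u <;> simp [h]

lemma avg_eq (α : ℝ) (f : V → ℝ) (u : V) :
    T.avg α f (T.sector u) = (T.measure α (T.sector u))⁻¹ *
      ∫⁻ y, (T.sector u).indicator (fun _ => 1) y * ‖f y‖ₑ ∂(T.measure α) := by
  rw [avg, setLAverage_eq, lintegral_indicator_sector_mul, ENNReal.div_eq_inv_mul]

lemma avg_mul_measure {α : ℝ} (hα : 1 < α) (f : V → ℝ) (u : V) :
    T.avg α f (T.sector u) * T.measure α (T.sector u) =
      ∫⁻ y, (T.sector u).indicator (fun _ => 1) y * ‖f y‖ₑ ∂(T.measure α) := by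
  have := T.isFiniteMeasure_measure hα
  rw [avg_eq, mul_comm, ← mul_assoc,
    ENNReal.mul_inv_cancel (T.measure_sector_pos α u).ne' (measure_ne_top _ _), one_mul]

lemma enorm_bergmanProj_le {α : ℝ} (hα : 1 < α) (f : V → ℝ) (x : V) :
    ‖T.bergmanProj α f x‖ₑ ≤ 4 *
      (∑' u, (T.sector u).indicator (fun _ => 1) x * T.avg α f (T.sector u) +
        ∑' v : {v // v ≠ T.root}, (∑' z : {z : V // z ≠ T.root ∧ T.parent z = T.parent v},
            (T.sector z).indicator (fun _ => 1) x) *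
          ((T.numChildren (T.parent v) : ℝ≥0∞)⁻¹ * T.avg α f (T.sector v))) := by
  have := T.countable_vertices
  calc ‖T.bergmanProj α f x‖ₑ ≤ ∫⁻ y, ‖T.bergmanKernel α x y * f y‖ₑ ∂(T.measure α) :=
        enorm_integral_le_lintegral_enorm _
    _ ≤ ∫⁻ y, 4 * (∑' u, (T.sector u).indicator (fun _ => 1) x *
          ((T.measure α (T.sector u))⁻¹ * ((T.sector u).indicator (fun _ => 1) y * ‖f y‖ₑ)) +
        ∑' v : {v // v ≠ T.root}, (∑' z : {z : V // z ≠ T.root ∧ T.parent z = T.parent v},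
            (T.sector z).indicator (fun _ => 1) x) *
          ((T.numChildren (T.parent v) : ℝ≥0∞)⁻¹ * ((T.measure α (T.sector v))⁻¹ *
            ((T.sector v).indicator (fun _ => 1) y * ‖f y‖ₑ)))) ∂(T.measure α) := by
        refine lintegral_mono fun y => ?_
        rw [enorm_mul]
        refine (mul_le_mul_left (T.enorm_bergmanKernel_le hα x y) _).trans (le_of_eq ?_)
        rw [mul_assoc, add_mul, ← ENNReal.tsum_mul_right, ← ENNReal.tsum_mul_right]
        simp_rw [mul_assoc]
    _ = _ := by
        rw [lintegral_const_mul _ Measurable.of_discrete, lintegral_add_left Measurable.of_discrete,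
          lintegral_tsum fun _ => Measurable.of_discrete.aemeasurable,
          lintegral_tsum fun _ => Measurable.of_discrete.aemeasurable]
        simp_rw [lintegral_const_mul _ Measurable.of_discrete, ← avg_eq]

/-- The pairing is dominated by the forms over the family of all sectors. -/
lemma lintegral_enorm_bergmanProj_mul_le {α : ℝ} (hα : 1 < α) (f₁ f₂ : V → ℝ) :
    ∫⁻ x, ‖T.bergmanProj α f₁ x * f₂ x‖ₑ ∂(T.measure α) ≤ 4 *
      (∑' u, T.avg α f₁ (T.sector u) *
          ∫⁻ x, (T.sector u).indicator (fun _ => 1) x * ‖f₂ x‖ₑ ∂(T.measure α) +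
        ∑' v : {v // v ≠ T.root}, T.avg α f₁ (T.sector v) *
          ((T.numChildren (T.parent v) : ℝ≥0∞)⁻¹ *
            ∑' z : {z : V // z ≠ T.root ∧ T.parent z = T.parent v}, T.avg α f₂ (T.sector z)) *
          T.measure α (T.sector v)) := by
  have := T.countable_vertices
  calc ∫⁻ x, ‖T.bergmanProj α f₁ x * f₂ x‖ₑ ∂(T.measure α) ≤
        ∫⁻ x, 4 * (∑' u, T.avg α f₁ (T.sector u) *
            ((T.sector u).indicator (fun _ => 1) x * ‖f₂ x‖ₑ) +
          ∑' v : {v // v ≠ T.root}, T.avg α f₁ (T.sector v) *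
            ((T.numChildren (T.parent v) : ℝ≥0∞)⁻¹ *
              ∑' z : {z : V // z ≠ T.root ∧ T.parent z = T.parent v},
                (T.sector z).indicator (fun _ => 1) x * ‖f₂ x‖ₑ)) ∂(T.measure α) := by
        refine lintegral_mono fun x => ?_
        rw [enorm_mul]
        refine (mul_le_mul_left (T.enorm_bergmanProj_le hα f₁ x) _).trans (le_of_eq ?_)
        rw [mul_assoc, add_mul, ← ENNReal.tsum_mul_right, ← ENNReal.tsum_mul_right]
        congr 2
        · exact tsum_congr fun u => by ring
        · refine tsum_congr fun v => ?_
          rw [ENNReal.tsum_mul_right]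
          ring
    _ = _ := by
        rw [lintegral_const_mul _ Measurable.of_discrete, lintegral_add_left Measurable.of_discrete,
          lintegral_tsum fun _ => Measurable.of_discrete.aemeasurable,
          lintegral_tsum fun _ => Measurable.of_discrete.aemeasurable]
        simp_rw [lintegral_const_mul _ Measurable.of_discrete]
        congr 2
        refine tsum_congr fun v => ?_
        rw [lintegral_tsum fun _ => Measurable.of_discrete.aemeasurable, mul_assoc, mul_assoc,
          ← ENNReal.tsum_mul_right]
        congr 2
        refine tsum_congr fun z => ?_
        rw [← T.avg_mul_measure hα, T.measure_sector_congr α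
          (T.level_of_mem_siblings v.2 (T.mem_children.2 z.2))]

/-! ### Sparse families of sectors -/

/-- A sector is charged to its first `m` generations; in one residue class these are disjoint. -/
lemma isSparse_residueSectors {α : ℝ} (hα : 1 < α) {m : ℕ}
    (hm : ((2 : ℝ) ^ (1 - α)) ^ m ≤ 1 / 2) (k : ℕ) : T.IsSparse α (T.residueSectors m k) := by
  refine ⟨?_, fun Q => {y | ∃ u, Q = T.sector u ∧ y ∈ T.sector u ∧ T.level y < T.level u + m},
    ?_, ?_⟩
  · rintro _ ⟨u, -, rfl⟩
    exact mem_iUnion.2 ⟨T.level u, Or.inr ⟨u, rfl, rfl⟩⟩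
  · rintro _ ⟨u, -, rfl⟩
    refine ⟨?_, (T.half_measure_sector_le hα hm u).trans
      (measure_mono fun y hy => ⟨u, rfl, hy⟩)⟩
    rintro y ⟨v, hv, hy, -⟩
    exact hv ▸ hy
  · rintro _ ⟨u, hu, rfl⟩ _ ⟨v, hv, rfl⟩ hne
    rw [Function.onFun, Set.disjoint_left]
    rintro y ⟨u', hu', hyu, hlu⟩ ⟨v', hv', hyv, hlv⟩
    obtain rfl := T.sector_injective hu'
    obtain rfl := T.sector_injective hv'
    refine hne (congrArg _ (T.eq_of_mem_sector hyu hyv ?_))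
    -- Two levels in the same residue class which differ by less than `m` agree.
    have h1 := T.level_le_of_mem_sector hyu
    have h2 := T.level_le_of_mem_sector hyv
    exact Nat.ModEq.eq_of_abs_lt (hu.trans hv.symm : T.level u ≡ T.level v [MOD m])
      (by rw [abs_lt]; constructor <;> omega)

lemma tsum_residue_le_sparseForm (α : ℝ) (m k : ℕ) (f₁ f₂ : V → ℝ) :
    ∑' u : {u : V | T.level u % m = k}, T.avg α f₁ (T.sector u) *
        ∫⁻ x, (T.sector (u : V)).indicator (fun _ => 1) x * ‖f₂ x‖ₑ ∂(T.measure α) ≤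
      T.sparseForm α (T.residueSectors m k) f₁ f₂ := by
  have := T.countable_vertices
  simp_rw [← lintegral_const_mul _ Measurable.of_discrete]
  rw [← lintegral_tsum fun _ => Measurable.of_discrete.aemeasurable, sparseForm]
  refine lintegral_mono fun x => ?_
  rw [sparseOp, ← ENNReal.tsum_mul_right]
  refine le_trans (le_of_eq (tsum_congr fun u => ?_)) (ENNReal.tsum_comp_le_tsum_of_injective
    (f := fun u : {u : V | T.level u % m = k} =>
      (⟨T.sector u, mem_image_of_mem _ u.2⟩ : T.residueSectors m k)) ?_ _)
  · by_cases h : x ∈ T.sector (u : V) <;> simp [h]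
  · intro u v h
    exact Subtype.ext (T.sector_injective (Subtype.mk.inj h))

set_option linter.unusedSectionVars false in
lemma tsum_residue_le_extraForm (α : ℝ) (m k : ℕ) (f₁ f₂ : V → ℝ) :
    ∑' v : {v : {v // v ≠ T.root} | T.level v % m = k}, T.avg α f₁ (T.sector v) *
        ((T.numChildren (T.parent v) : ℝ≥0∞)⁻¹ *
          ∑' z : {z : V // z ≠ T.root ∧ T.parent z = T.parent v}, T.avg α f₂ (T.sector z)) *
        T.measure α (T.sector v) ≤
      T.extraForm α (T.residueSectors m k) f₁ f₂ := by
  refine le_trans (ENNReal.tsum_le_tsum fun v => ?_) (ENNReal.tsum_comp_le_tsum_of_injective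
    (f := fun v : {v : {v // v ≠ T.root} | T.level v % m = k} =>
      (⟨v, v.1.2, T.sector_mem_residueSectors.2 v.2⟩ :
        {y : V // y ≠ T.root ∧ T.sector y ∈ T.residueSectors m k})) ?_ _)
  · dsimp only
    gcongr
    -- Siblings have the same level, so the residue class imposes no further condition on them.
    have hz : ∀ z : {z : V // z ≠ T.root ∧ T.parent z = T.parent v},
        T.sector z ∈ T.residueSectors m k := by
      intro z
      rw [sector_mem_residueSectors, T.level_of_mem_siblings v.1.2 (T.mem_children.2 z.2)]
      exact v.2
    exact ENNReal.tsum_comp_le_tsum_of_injective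
      (f := fun z : {z : V // z ≠ T.root ∧ T.parent z = T.parent v} =>
        (⟨z, z.2.1, hz z, z.2.2⟩ : {z : V // z ≠ T.root ∧ T.sector z ∈ T.residueSectors m k ∧
          T.parent z = T.parent v}))
      (fun z w h => Subtype.ext (Subtype.mk.inj h)) fun z => T.avg α f₂ (T.sector z)
  · intro v w h
    exact Subtype.ext (Subtype.ext (Subtype.mk.inj h))

/-- One of the `m` residue classes carries at least the average of the forms over all sectors. -/
lemma exists_residue_lintegral_le {α : ℝ} (hα : 1 < α) {m : ℕ} (hm : 0 < m) (f₁ f₂ : V → ℝ) :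
    ∃ k, ∫⁻ x, ‖T.bergmanProj α f₁ x * f₂ x‖ₑ ∂(T.measure α) ≤ 4 * m *
      (T.sparseForm α (T.residueSectors m k) f₁ f₂ +
        T.extraForm α (T.residueSectors m k) f₁ f₂) := by
  obtain ⟨k, -, hk⟩ := Finset.exists_max_image (Finset.range m)
    (fun k => T.sparseForm α (T.residueSectors m k) f₁ f₂ +
      T.extraForm α (T.residueSectors m k) f₁ f₂) ⟨0, Finset.mem_range.2 hm⟩
  refine ⟨k, (T.lintegral_enorm_bergmanProj_mul_le hα f₁ f₂).trans ?_⟩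
  rw [tsum_eq_sum_residues T.level hm,
    tsum_eq_sum_residues (fun v : {v // v ≠ T.root} => T.level v) hm, ← Finset.sum_add_distrib,
    mul_assoc]
  gcongr
  calc _ ≤ ∑ i ∈ Finset.range m, (T.sparseForm α (T.residueSectors m i) f₁ f₂ +
        T.extraForm α (T.residueSectors m i) f₁ f₂) := by
        refine Finset.sum_le_sum fun i _ => add_le_add ?_ ?_
        · exact T.tsum_residue_le_sparseForm α m i f₁ f₂
        · exact T.tsum_residue_le_extraForm α m i f₁ f₂
    _ ≤ _ := (Finset.sum_le_card_nsmul _ _ _ hk).trans (by rw [Finset.card_range, nsmul_eq_mul])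

end RadialTree

end

theorem theoremA (α : ℝ) (hα : 1 < α) :
    ∃ C : ℝ≥0, ∀ (V : Type*) [MeasurableSpace V] [DiscreteMeasurableSpace V]
      (T : RadialTree V) (f₁ f₂ : V → ℝ),
      Integrable f₁ (T.measure α) → Integrable f₂ (T.measure α) →
      (∀ x, Integrable (fun y => T.bergmanKernel α x y * f₁ y) (T.measure α)) ∧
      ∃ S : Set (Set V), T.IsSparse α S ∧
        (T.sparseForm α S f₁ f₂ + T.extraForm α S f₁ f₂ ≠ ∞ →
          Integrable (fun x => T.bergmanProj α f₁ x * f₂ x) (T.measure α)) ∧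
        ‖∫ x, T.bergmanProj α f₁ x * f₂ x ∂(T.measure α)‖ₑ ≤
          C * (T.sparseForm α S f₁ f₂ + T.extraForm α S f₁ f₂) := by
  have hr : (2 : ℝ) ^ (1 - α) < 1 := Real.rpow_lt_one_of_one_lt_of_neg one_lt_two (by linarith)
  obtain ⟨m, hm⟩ := exists_pow_lt_of_lt_one one_half_pos hr
  have hm0 : 0 < m := by
    refine Nat.pos_of_ne_zero ?_
    rintro rfl
    norm_num at hm
  refine ⟨4 * m, fun V _ _ T f₁ f₂ hf₁ _ => ⟨fun x => ?_, ?_⟩⟩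
  · obtain ⟨c, hc⟩ := T.exists_norm_explicitKernel_le α x
    rw [T.bergmanKernel_eq hα]
    exact T.integrable_mul_of_norm_le hc hf₁
  · obtain ⟨k, hk⟩ := T.exists_residue_lintegral_le hα hm0 f₁ f₂
    refine ⟨T.residueSectors m k, T.isSparse_residueSectors hα hm.le k, fun hfin => ?_, ?_⟩
    · refine ⟨T.aestronglyMeasurable_of_discrete α _, hk.trans_lt ?_⟩
      exact ENNReal.mul_lt_top (ENNReal.mul_lt_top (by simp) (by simp)) hfin.lt_top
    · refine (enorm_integral_le_lintegral_enorm _).trans (hk.trans (le_of_eq ?_))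
      push_cast
      rfl
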